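/- **Theorem (Small object argument).** Let $\mathbf C$ be a strict $(2,1)$-category (a strict 2-category all of whose 2-cells are invertible) that is locally small and 2-cocomplete, i.e. every strict 2-functor $F:\mathcal K\to\mathbf C$ from a small strict $(2,1)$-category has a 2-colimit: an object $d$ with a pseudonatural transformation $\iota:F\Rightarrow\Delta(d)$ such that, for every object $a$, the functor $\iota^*:\mathbf C(d,a)\to \mathrm{Nat}(F,\Delta(a))$ to the category of pseudonatural transformations and modifications is an equivalence of categories. 2-colimits of pseudofunctors, and 2-pushouts, are defined by the same universal property. For an ordinal $\lambda$, seen as a $(2,1)$-category with trivial 2-cells, a *$\lambda$-sequence* is a pseudofunctor $X_\bullet:\lambda\to\mathbf C$ such that for every limit ordinal $\beta<\lambda$ the object $X_\beta$, with the transition maps $X_\alpha\to X_\beta$ and the structural 2-cells, is the 2-colimit of $(X_\alpha)_{\alpha<\beta}$; its *steps* are the maps $X_\alpha\to X_{\alpha+1}$ with $\alpha+1<\lambda$. If $\lambda>0$ and $X$ is a 2-colimit of $X_\bullet$, the coprojection $X_0\to X$ is called a *transfinite composition* of the steps. Let $I$ be a (small) set of arrows of $\mathbf C$. * *$I$-cell*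 is the class of arrows that are transfinite compositions of 2-pushouts of arrows in $I$. * *$I$-inj* is the class of arrows $f:X\to Y$ such that for all $g:C\to D$ in $I$, all $h:C\to X$, $h':D\to Y$ and every 2-cell $\eta:h'g\Rightarrow fh$ there are $k:D\to X$ and 2-cells $\nu_1:kg\Rightarrow h$, $\nu_2:h'\Rightarrow fk$ with $f\nu_1\circ\nu_2g=\eta$. * An object $A$ is *small relative to $I$-cell* if there is a cardinal $\kappa$ such that, for every limit ordinal $\mu>0$ of cofinality greater than $\kappa$ and every $\mu$-sequence whose steps are in $I$-cell, the 2-functor $\mathbf C(A,-)$ preserves the 2-colimits of this $\mu$-sequence. Assume that the domain of every arrow in $I$ is small relative to $I$-cell. Then for every arrow $f:X\to Y$ of $\mathbf C$ there are arrows $f':X\to Z$ and $f'':Z\to Y$ with $f'\in I$-cell, $f''\in I$-inj and $f''\circ f'\cong f$. -/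

import Mathlib

open CategoryTheory Bicategory

universe w₁ w₂ w₃ v₁ v₂ v₃ u₁ u₂ u₃ v u

namespace TwoOne

section Colimits

variable {K : Type u₁} [Bicategory.{w₁, v₁} K] {C : Type u₂} [Bicategory.{w₂, v₂} C]
  {D : Type u₃} [Bicategory.{w₃, v₃} D]

/-- A pseudonatural transformation from `F` to the constant 2-functor with value `a`: its
components `ι i : F i ⟶ a` and invertible 2-cells `F f ≫ ι j ≅ ι i` (composition is written in
diagrammatic order), subject to the coherence conditions of a pseudonatural transformation. -/
structure PseudoCocone (F : K ⥤ᵖ C) (a : C) where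
  ι (i : K) : F.obj i ⟶ a
  comm {i j : K} (f : i ⟶ j) : F.map f ≫ ι j ≅ ι i
  comm_naturality {i j : K} {f g : i ⟶ j} (η : f ⟶ g) :
    F.map₂ η ▷ ι j ≫ (comm g).hom = (comm f).hom
  comm_id (i : K) : (comm (𝟙 i)).hom = (F.mapId i).hom ▷ ι i ≫ (λ_ (ι i)).hom
  comm_comp {i j k : K} (f : i ⟶ j) (g : j ⟶ k) :
    (comm (f ≫ g)).hom = (F.mapComp f g).hom ▷ ι k ≫
      (α_ (F.map f) (F.map g) (ι k)).hom ≫ F.map f ◁ (comm g).hom ≫ (comm f).hom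

namespace PseudoCocone

variable {F : K ⥤ᵖ C} {a : C}

/-- A modification between pseudonatural transformations from `F` to a constant 2-functor. -/
@[ext]
structure Hom (c d : PseudoCocone F a) where
  app (i : K) : c.ι i ⟶ d.ι i
  naturality {i j : K} (f : i ⟶ j) :
    F.map f ◁ app j ≫ (d.comm f).hom = (c.comm f).hom ≫ app i

/-- The category of pseudonatural transformations from `F` to the constant 2-functor with value
`a`, and modifications. -/
instance : Category (PseudoCocone F a) where
  Hom := Hom
  id c := { app := fun i => 𝟙 (c.ι i), naturality := by intros; simp }
  comp p q :=
    { app := fun i => p.app i ≫ q.app i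
      naturality := by
        intro i j f
        rw [whiskerLeft_comp, Category.assoc, q.naturality, ← Category.assoc, p.naturality,
          Category.assoc] }
  id_comp _ := by apply Hom.ext; funext i; exact Category.id_comp _
  comp_id _ := by apply Hom.ext; funext i; exact Category.comp_id _
  assoc _ _ _ := by apply Hom.ext; funext i; exact Category.assoc _ _ _

/-- Postcomposition of a cocone with a 1-cell. -/
def postcomp (c : PseudoCocone F a) {b : C} (r : a ⟶ b) : PseudoCocone F b where
  ι i := c.ι i ≫ r
  comm {i j} f := (α_ (F.map f) (c.ι j) r).symm ≪≫ whiskerRightIso (c.comm f) r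
  comm_naturality {i j f g} η := by
    simp [← c.comm_naturality η]
  comm_id i := by
    simp [c.comm_id]
  comm_comp f g := by
    simp [c.comm_comp]

/-- The functor `C(a, b) ⥤ Nat(F, Δ(b))` given by postcomposition. -/
def homFunctor (c : PseudoCocone F a) (b : C) : (a ⟶ b) ⥤ PseudoCocone F b where
  obj r := c.postcomp r
  map {r s} η :=
    { app := fun i => c.ι i ◁ η
      naturality := by
        intro i j f
        change F.map f ◁ c.ι j ◁ η ≫ (α_ (F.map f) (c.ι j) s).inv ≫ (c.comm f).hom ▷ s =
          ((α_ (F.map f) (c.ι j) r).inv ≫ (c.comm f).hom ▷ r) ≫ c.ι i ◁ η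
        rw [Category.assoc, ← whisker_exchange, associator_inv_naturality_right_assoc] }
  map_id _ := by apply Hom.ext; funext i; exact whiskerLeft_id _ _
  map_comp _ _ := by apply Hom.ext; funext i; exact whiskerLeft_comp _ _ _

/-- The cocone `c` exhibits its vertex as a 2-colimit of `F`: for every object `b`, the functor
`C(a, b) ⥤ Nat(F, Δ(b))` is an equivalence of categories. -/
def IsColimit (c : PseudoCocone F a) : Prop :=
  ∀ b : C, (c.homFunctor b).IsEquivalence

/-- The image of a cocone under a pseudofunctor. -/
def image (c : PseudoCocone F a) (G : C ⥤ᵖ D) : PseudoCocone (F.comp G) (G.obj a) where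
  ι i := G.map (c.ι i)
  comm {i j} f := (G.mapComp (F.map f) (c.ι j)).symm ≪≫ G.map₂Iso (c.comm f)
  comm_naturality {i j f g} η := by
    change G.map₂ (F.map₂ η) ▷ G.map (c.ι j) ≫ (G.mapComp (F.map g) (c.ι j)).inv ≫
      G.map₂ (c.comm g).hom = (G.mapComp (F.map f) (c.ι j)).inv ≫ G.map₂ (c.comm f).hom
    simp [← c.comm_naturality η]
  comm_id i := by
    change (G.mapComp (F.map (𝟙 i)) (c.ι i)).inv ≫ G.map₂ (c.comm (𝟙 i)).hom =
      (G.map₂ (F.mapId i).hom ≫ (G.mapId (F.obj i)).hom) ▷ G.map (c.ι i) ≫ (λ_ (G.map (c.ι i))).hom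
    simp [c.comm_id]
  comm_comp {i j k} f g := by
    change (G.mapComp (F.map (f ≫ g)) (c.ι k)).inv ≫ G.map₂ (c.comm (f ≫ g)).hom =
      (G.map₂ (F.mapComp f g).hom ≫ (G.mapComp (F.map f) (F.map g)).hom) ▷ G.map (c.ι k) ≫
        (α_ (G.map (F.map f)) (G.map (F.map g)) (G.map (c.ι k))).hom ≫
          G.map (F.map f) ◁ ((G.mapComp (F.map g) (c.ι k)).inv ≫ G.map₂ (c.comm g).hom) ≫
            (G.mapComp (F.map f) (c.ι j)).inv ≫ G.map₂ (c.comm f).hom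
    simp [c.comm_comp]

end PseudoCocone

/-- A square filled with an invertible 2-cell, under the span `X ⟵ A ⟶ B`, with vertex `a`. -/
structure SpanCocone {A B X : C} (h : A ⟶ X) (g : A ⟶ B) (a : C) where
  inl : X ⟶ a
  inr : B ⟶ a
  iso : h ≫ inl ≅ g ≫ inr

namespace SpanCocone

variable {A B X : C} {h : A ⟶ X} {g : A ⟶ B} {a : C}

/-- A pair of 2-cells compatible with the 2-cells that fill the two squares. -/
@[ext]
structure Hom (s t : SpanCocone h g a) where
  left : s.inl ⟶ t.inl
  right : s.inr ⟶ t.inr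
  w : h ◁ left ≫ t.iso.hom = s.iso.hom ≫ g ◁ right

instance : Category (SpanCocone h g a) where
  Hom := Hom
  id s := { left := 𝟙 s.inl, right := 𝟙 s.inr, w := by simp }
  comp p q :=
    { left := p.left ≫ q.left
      right := p.right ≫ q.right
      w := by
        rw [whiskerLeft_comp, Category.assoc, q.w, ← Category.assoc, p.w, Category.assoc,
          whiskerLeft_comp] }
  id_comp _ := Hom.ext (Category.id_comp _) (Category.id_comp _)
  comp_id _ := Hom.ext (Category.comp_id _) (Category.comp_id _)
  assoc _ _ _ := Hom.ext (Category.assoc _ _ _) (Category.assoc _ _ _)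

/-- Postcomposition of a square under a span with a 1-cell. -/
def postcomp (s : SpanCocone h g a) {b : C} (r : a ⟶ b) : SpanCocone h g b where
  inl := s.inl ≫ r
  inr := s.inr ≫ r
  iso := (α_ h s.inl r).symm ≪≫ whiskerRightIso s.iso r ≪≫ α_ g s.inr r

/-- Postcomposition, as a functor from `C(a, b)` to the category of squares with vertex `b`. -/
def homFunctor (s : SpanCocone h g a) (b : C) : (a ⟶ b) ⥤ SpanCocone h g b where
  obj r := s.postcomp r
  map {r r'} η :=
    { left := s.inl ◁ η
      right := s.inr ◁ η
      w := by
        change h ◁ s.inl ◁ η ≫ (α_ h s.inl r').inv ≫ s.iso.hom ▷ r' ≫ (α_ g s.inr r').hom =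
          ((α_ h s.inl r).inv ≫ s.iso.hom ▷ r ≫ (α_ g s.inr r).hom) ≫ g ◁ s.inr ◁ η
        simp only [Category.assoc]
        rw [← associator_naturality_right, ← whisker_exchange_assoc,
          associator_inv_naturality_right_assoc] }
  map_id _ := Hom.ext (whiskerLeft_id _ _) (whiskerLeft_id _ _)
  map_comp _ _ := Hom.ext (whiskerLeft_comp _ _ _) (whiskerLeft_comp _ _ _)

/-- The square is a 2-pushout, i.e. a 2-colimit of the span. -/
def IsPushout (s : SpanCocone h g a) : Prop :=
  ∀ b : C, (s.homFunctor b).IsEquivalence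

end SpanCocone

end Colimits

/-- `C` is 2-cocomplete: every strict 2-functor from a small strict (2,1)-category to `C` has a
2-colimit. -/
def TwoCocomplete (C : Type u) [Bicategory.{v, v} C] : Prop :=
  ∀ (K : Type v) [Bicategory.{v, v} K] [Bicategory.Strict K] [IsLocallyGroupoid K]
    (F : StrictPseudofunctor K C),
    ∃ (a : C) (c : PseudoCocone F.toPseudofunctor a), c.IsColimit

section Sequences

variable {C : Type u₂} [Bicategory.{w₂, v₂} C] {J : Type u₁} [LinearOrder J]

/-- A linear order is seen as a (2,1)-category with trivial 2-cells, and a diagram of this shape is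
a pseudofunctor: its triangles commute up to coherent invertible 2-cells. This is the transition
1-cell `F i ⟶ F j` of such a diagram. -/
def trans (F : LocallyDiscrete J ⥤ᵖ C) {i j : J} (h : i ≤ j) : F.obj ⟨i⟩ ⟶ F.obj ⟨j⟩ :=
  F.map (homOfLE h).toLoc

/-- The restriction of a diagram `F` to the initial segment of the indices below `j`. -/
def restrict (F : LocallyDiscrete J ⥤ᵖ C) (j : J) : LocallyDiscrete (Set.Iio j) ⥤ᵖ C :=
  (Functor.toPseudofunctor (Subtype.mono_coe (· ∈ Set.Iio j)).functor).comp F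

/-- The canonical cocone with vertex `F j` on the restriction of `F` to the indices below `j`. -/
def coconeAt (F : LocallyDiscrete J ⥤ᵖ C) (j : J) :
    PseudoCocone (restrict F j) (F.obj ⟨j⟩) where
  ι i := trans F (le_of_lt i.as.2)
  comm {i i'} f := (F.mapComp (homOfLE (leOfHom f.as) : i.as.1 ⟶ i'.as.1).toLoc
    (homOfLE (le_of_lt i'.as.2)).toLoc).symm
  comm_naturality {i i' f g} η := by
    obtain rfl := LocallyDiscrete.eq_of_hom η
    have h : (restrict F j).map₂ η = 𝟙 _ := by
      rw [Subsingleton.elim η (𝟙 f)]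
      exact (restrict F j).map₂_id f
    rw [h]
    exact (congrArg (· ≫ _) (id_whiskerRight _ _)).trans (Category.id_comp _)
  comm_id i := by
    have h := F.map₂_left_unitor (homOfLE (le_of_lt i.as.2) : i.as.1 ⟶ j).toLoc
    have h₁ : F.map₂ (λ_ (homOfLE (le_of_lt i.as.2) : i.as.1 ⟶ j).toLoc).hom = 𝟙 _ :=
      F.map₂_id _
    have h₂ : ((restrict F j).mapId i).hom = (F.mapId ⟨i.as.1⟩).hom :=
      (congrArg (· ≫ (F.mapId ⟨i.as.1⟩).hom) (F.map₂_id _)).trans (Category.id_comp _)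
    rw [h₁] at h
    rw [h₂]
    exact (Category.comp_id _).symm.trans ((Iso.inv_comp_eq _).2 h)
  comm_comp {i i' i''} f g := by
    have h := F.map₂_associator (homOfLE (leOfHom f.as) : i.as.1 ⟶ i'.as.1).toLoc
      (homOfLE (leOfHom g.as) : i'.as.1 ⟶ i''.as.1).toLoc
      (homOfLE (le_of_lt i''.as.2) : i''.as.1 ⟶ j).toLoc
    have h₁ : F.map₂ (α_ (homOfLE (leOfHom f.as) : i.as.1 ⟶ i'.as.1).toLoc
      (homOfLE (leOfHom g.as) : i'.as.1 ⟶ i''.as.1).toLoc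
      (homOfLE (le_of_lt i''.as.2) : i''.as.1 ⟶ j).toLoc).hom = 𝟙 _ := F.map₂_id _
    have h₂ : ((restrict F j).mapComp f g).hom = (F.mapComp
        (homOfLE (leOfHom f.as) : i.as.1 ⟶ i'.as.1).toLoc
        (homOfLE (leOfHom g.as) : i'.as.1 ⟶ i''.as.1).toLoc).hom :=
      (congrArg (· ≫ _) (F.map₂_id _)).trans (Category.id_comp _)
    rw [h₂]
    rw [h₁] at h
    exact (Category.comp_id _).symm.trans ((Iso.inv_comp_eq _).2 h)

/-- The diagram preserves 2-colimits: for every limit index `j`, its value at `j` is the 2-colimit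
of its values at the indices below `j`. -/
def IsContinuous (F : LocallyDiscrete J ⥤ᵖ C) : Prop :=
  ∀ j : J, Order.IsSuccLimit j → (coconeAt F j).IsColimit

/-- `J` has no largest element, and every subset of `J` of cardinality at most `κ` is bounded. For
a well-order `J` this says that its order type is a nonzero limit ordinal of cofinality greater
than `κ`. -/
def IsFilteredOrder (κ : Cardinal.{u₁}) (J : Type u₁) [LinearOrder J] : Prop :=
  NoMaxOrder J ∧ ∀ S : Set J, Cardinal.mk S ≤ κ → BddAbove S

/-- The representable 2-functor `C(X, -)`. -/
def representable (X : C) : C ⥤ᵖ Cat.{w₂, v₂} where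
  toPrelaxFunctor := PrelaxFunctor.mkOfHomFunctors (fun a => Cat.of (X ⟶ a))
    (fun a b => postcomposingCat X a b)
  mapId a := rightUnitorNatIsoCat X a
  mapComp f g := (associatorNatIsoLeftCat X f g).symm
  map₂_whisker_left {a b c} f g h η := by
    have key : ∀ p : X ⟶ a, p ◁ f ◁ η = (α_ p f g).inv ≫ (p ≫ f) ◁ η ≫ (α_ p f h).hom := by
      simp
    ext p
    exact key p
  map₂_whisker_right {a b c f g} η h := by
    have key : ∀ p : X ⟶ a, p ◁ η ▷ h = (α_ p f h).inv ≫ (p ◁ η) ▷ h ≫ (α_ p g h).hom := by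
      simp
    ext p
    exact key p
  map₂_associator {a b c d} f g h := by
    have key : ∀ p : X ⟶ a, p ◁ (α_ f g h).hom = (α_ p (f ≫ g) h).inv ≫ (α_ p f g).inv ▷ h ≫
        𝟙 _ ≫ (α_ (p ≫ f) g h).hom ≫ (α_ p f (g ≫ h)).hom := by
      simp
    ext p
    exact key p
  map₂_left_unitor {a b} f := by
    have key : ∀ p : X ⟶ a, p ◁ (λ_ f).hom = (α_ p (𝟙 a) f).inv ≫ (ρ_ p).hom ▷ f ≫ 𝟙 _ := by
      simp
    ext p
    exact key p
  map₂_right_unitor {a b} f := by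
    have key : ∀ p : X ⟶ a, p ◁ (ρ_ f).hom = (α_ p f (𝟙 b)).inv ≫ (ρ_ (p ≫ f)).hom ≫ 𝟙 _ := by
      simp
    ext p
    exact key p

end Sequences

/-- The 1-cells of `C`. -/
structure Arr (C : Type u₁) [Bicategory.{w₁, v₁} C] where
  {left right : C}
  hom : left ⟶ right

section CellInj

variable {C : Type u} [Bicategory.{v, v} C]

/-- The 2-pushouts of the 1-cells in `I`, along arbitrary 1-cells. -/
def pushouts (I : Set (Arr C)) : Set (Arr C) :=
  {f | ∃ g ∈ I, ∃ (h : g.left ⟶ f.left) (s : SpanCocone h g.hom f.right),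
    s.IsPushout ∧ s.inl = f.hom}

/-- The transfinite compositions of 1-cells in `W`: the coprojections `F 0 ⟶ colim F` for a
nonempty small well-order `J` and a continuous diagram `F` of shape `J` all of whose successor
steps are in `W`. -/
def transfiniteCompositions (W : Set (Arr C)) : Set (Arr C) :=
  {f | ∃ (J : Type v) (_ : LinearOrder J) (_ : WellFoundedLT J) (_ : OrderBot J)
    (F : LocallyDiscrete J ⥤ᵖ C) (a : C) (c : PseudoCocone F a),
    IsContinuous F ∧ (∀ (i j : J) (h : i ⋖ j), Arr.mk (trans F h.le) ∈ W) ∧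
      c.IsColimit ∧ f = Arr.mk (c.ι ⟨⊥⟩)}

/-- The class `I`-cell of transfinite compositions of 2-pushouts of 1-cells in `I`. -/
def cell (I : Set (Arr C)) : Set (Arr C) :=
  transfiniteCompositions (pushouts I)

/-- The class `I`-inj of 1-cells with the right lifting property with respect to `I`. -/
def inj (I : Set (Arr C)) : Set (Arr C) :=
  {f | ∀ g ∈ I, ∀ (h : g.left ⟶ f.left) (h' : g.right ⟶ f.right)
    (η : g.hom ≫ h' ⟶ h ≫ f.hom),
    ∃ (k : g.right ⟶ f.left) (ν₁ : g.hom ≫ k ⟶ h) (ν₂ : h' ⟶ k ≫ f.hom),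
      g.hom ◁ ν₂ ≫ (α_ g.hom k f.hom).inv ≫ ν₁ ▷ f.hom = η}

/-- `X` is `κ`-small relative to `W`: the 2-functor `C(X, -)` preserves the 2-colimit of every
continuous diagram with steps in `W` whose shape is a well-order that is `κ`-filtered. -/
def IsCardinalSmall (W : Set (Arr C)) (κ : Cardinal.{v}) (X : C) : Prop :=
  ∀ (J : Type v) [LinearOrder J] [WellFoundedLT J], IsFilteredOrder κ J →
    ∀ F : LocallyDiscrete J ⥤ᵖ C, IsContinuous F →
      (∀ (i j : J) (h : i ⋖ j), Arr.mk (trans F h.le) ∈ W) →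
      ∀ (a : C) (c : PseudoCocone F a), c.IsColimit → (c.image (representable X)).IsColimit

/-- `X` is small relative to `W`. -/
def IsSmall (W : Set (Arr C)) (X : C) : Prop :=
  ∃ κ : Cardinal.{v}, IsCardinalSmall W κ X

end CellInj

end TwoOne

namespace TwoOne

/-! ### Augmented pseudofunctors on preorders. -/

section Chains

variable {C : Type u₂} [Bicategory.{w₂, v₂} C]

/-! The factorization is built by attaching one cell at a time. The construction starts from f. At a
successor, a lifting problem against I that the current map to Y leaves unsolved is chosen, posed at
the earliest possible stage, and a 2-pushout solves it; at a limit the 2-colimit is taken. The maps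
to Y and their coherent 2-cells come from the universal properties. If some stage has its map to Y
in I-inj, the diagram up to that stage is the required factorization (`factors_of_mem_inj`).

Suppose no stage does. Then the diagram continues along all ordinals (`exists_good`). The problems
posed up to a stage b form a small set, and a solved problem stays solved. By the earliest-first
rule each later step uses up a new one of them as long as one is left, so all of them are solved by
some stage g b (`exists_solved`). Take a limit ordinal o closed under g in a weak sense and of
cofinality above all smallness bounds (`exists_closed`). The problem treated in the step from o to o
+ 1 has a small domain, so its top 1-cell at o comes, up to isomorphism, from a stage b below o
(`exists_earlier`). It thus reduces to a problem posed at b (`exists_problem`), which is solved at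
o. But the step treats a problem unsolved at o: a contradiction.

Two technical points shape the rest. Cocompleteness speaks of strict 2-functors while the diagrams
are pseudofunctors, so a pseudofunctor is replaced by a strict 2-functor on its classifier `Str`,
with an equivalent category of cocones. And the recursion needs extensions that restrict on the
nose: `snoc` adds a last object without changing the old data, and `exists_glue` glues diagrams that
agree strictly. -/

theorem inv_eq_of_assoc {a b c d : C} {x : a ⟶ b} {y : b ⟶ c} {z : c ⟶ d} {p : a ⟶ c} {q : b ⟶ d}
    {m : a ⟶ d} (α : m ≅ p ≫ z) (β : p ≅ x ≫ y) (γ : m ≅ x ≫ q) (δ : q ≅ y ≫ z)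
    (h : α.hom ≫ β.hom ▷ z ≫ (α_ x y z).hom = γ.hom ≫ x ◁ δ.hom) :
    α.inv = β.hom ▷ z ≫ (α_ x y z).hom ≫ x ◁ δ.inv ≫ γ.inv := by
  have h' := congrArg (· ≫ x ◁ δ.inv ≫ γ.inv) h
  simp only [Category.assoc, whiskerLeft_hom_inv_assoc, Iso.hom_inv_id] at h'
  exact (Category.comp_id _).symm.trans ((Iso.inv_comp_eq _).2 h'.symm)

/-- The 1-cells of a diagram of shape a preorder, augmented to `Y`. -/
structure ChainMaps (Y : C) {K : Type u₁} [Preorder K] (o : K → C) where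
  map {i j : K} (h : i ≤ j) : o i ⟶ o j
  aug (i : K) : o i ⟶ Y

/-- The coherent invertible 2-cells of a diagram of shape a preorder, augmented to `Y`. -/
structure ChainCells {Y : C} {K : Type u₁} [Preorder K] {o : K → C} (m : ChainMaps Y o) where
  mapId (i : K) : m.map (le_refl i) ≅ 𝟙 (o i)
  mapComp {i j k : K} (h : i ≤ j) (h' : j ≤ k) : m.map (h.trans h') ≅ m.map h ≫ m.map h'
  augComp {i j : K} (h : i ≤ j) : m.map h ≫ m.aug j ≅ m.aug i
  assoc {i j k l : K} (h : i ≤ j) (h' : j ≤ k) (h'' : k ≤ l) :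
    (mapComp (h.trans h') h'').hom ≫ (mapComp h h').hom ▷ m.map h'' ≫ (α_ _ _ _).hom =
      (mapComp h (h'.trans h'')).hom ≫ m.map h ◁ (mapComp h' h'').hom
  left_unit {i j : K} (h : i ≤ j) :
    (mapComp (le_refl i) h).hom ≫ (mapId i).hom ▷ m.map h ≫ (λ_ _).hom = 𝟙 _
  right_unit {i j : K} (h : i ≤ j) :
    (mapComp h (le_refl j)).hom ≫ m.map h ◁ (mapId j).hom ≫ (ρ_ _).hom = 𝟙 _
  aug_id (i : K) : (augComp (le_refl i)).hom = (mapId i).hom ▷ m.aug i ≫ (λ_ _).hom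
  aug_comp {i j k : K} (h : i ≤ j) (h' : j ≤ k) :
    (augComp (h.trans h')).hom = (mapComp h h').hom ▷ m.aug k ≫ (α_ _ _ _).hom ≫
      m.map h ◁ (augComp h').hom ≫ (augComp h).hom

/-- A pseudofunctor from a preorder to `C`, together with a pseudococone with vertex `Y`. -/
structure Chain (Y : C) (K : Type u₁) [Preorder K] where
  obj : K → C
  maps : ChainMaps Y obj
  cells : ChainCells maps

namespace Chain

variable {Y : C} {K : Type u₁} [Preorder K] {K' : Type u₃} [Preorder K']

abbrev map (G : Chain Y K) {i j : K} (h : i ≤ j) : G.obj i ⟶ G.obj j := G.maps.map h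

abbrev aug (G : Chain Y K) (i : K) : G.obj i ⟶ Y := G.maps.aug i

abbrev mapId (G : Chain Y K) (i : K) : G.map (le_refl i) ≅ 𝟙 (G.obj i) := G.cells.mapId i

abbrev mapComp (G : Chain Y K) {i j k : K} (h : i ≤ j) (h' : j ≤ k) :
    G.map (h.trans h') ≅ G.map h ≫ G.map h' := G.cells.mapComp h h'

abbrev augComp (G : Chain Y K) {i j : K} (h : i ≤ j) : G.map h ≫ G.aug j ≅ G.aug i :=
  G.cells.augComp h

/-- Restriction of the 1-cells along a monotone map. -/
def _root_.TwoOne.ChainMaps.pull {o : K → C} (m : ChainMaps Y o) (e : K' →o K) :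
    ChainMaps Y (fun k => o (e k)) where
  map h := m.map (e.monotone h)
  aug i := m.aug (e i)

/-- Restriction of the 2-cells along a monotone map. -/
def _root_.TwoOne.ChainCells.pull {o : K → C} {m : ChainMaps Y o} (t : ChainCells m)
    (e : K' →o K) : ChainCells (m.pull e) where
  mapId i := t.mapId (e i)
  mapComp h h' := t.mapComp (e.monotone h) (e.monotone h')
  augComp h := t.augComp (e.monotone h)
  assoc h h' h'' := t.assoc (e.monotone h) (e.monotone h') (e.monotone h'')
  left_unit h := t.left_unit (e.monotone h)
  right_unit h := t.right_unit (e.monotone h)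
  aug_id i := t.aug_id (e i)
  aug_comp h h' := t.aug_comp (e.monotone h) (e.monotone h')

/-- Restriction along a monotone map. -/
def pull (G : Chain Y K) (e : K' →o K) : Chain Y K' where
  obj k := G.obj (e k)
  maps := G.maps.pull e
  cells := G.cells.pull e

/-- The pseudofunctor underlying an augmented diagram. -/
def toPseudo (G : Chain Y K) : LocallyDiscrete K ⥤ᵖ C where
  obj i := G.obj i.as
  map f := G.map (leOfHom f.as)
  map₂ _ := 𝟙 _
  map₂_id _ := rfl
  map₂_comp _ _ := (Category.comp_id _).symm
  mapId i := G.mapId i.as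
  mapComp f g := G.mapComp (leOfHom f.as) (leOfHom g.as)
  map₂_whisker_left f g h η := by
    rw [whiskerLeft_id, Category.id_comp]
    exact (Iso.hom_inv_id _).symm
  map₂_whisker_right η h := by
    rw [id_whiskerRight, Category.id_comp]
    exact (Iso.hom_inv_id _).symm
  map₂_associator f g h := by
    have := inv_eq_of_assoc _ _ _ _
      (G.cells.assoc (leOfHom f.as) (leOfHom g.as) (leOfHom h.as))
    exact (Iso.hom_inv_id (G.mapComp (leOfHom (f ≫ g).as) (leOfHom h.as))).symm.trans
      (congrArg ((G.mapComp (leOfHom (f ≫ g).as) (leOfHom h.as)).hom ≫ ·) this)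
  map₂_left_unitor f := (G.cells.left_unit (leOfHom f.as)).symm
  map₂_right_unitor f := (G.cells.right_unit (leOfHom f.as)).symm

/-- A cocone on a chain from its underlying data. -/
def mkCocone (G : Chain Y K) {a : C} (ι : ∀ i, G.obj i ⟶ a)
    (comm : ∀ {i j : K} (h : i ≤ j), G.map h ≫ ι j ≅ ι i)
    (comm_id : ∀ i, (comm (le_refl i)).hom = (G.mapId i).hom ▷ ι i ≫ (λ_ _).hom)
    (comm_comp : ∀ {i j k : K} (h : i ≤ j) (h' : j ≤ k),
      (comm (h.trans h')).hom = (G.mapComp h h').hom ▷ ι k ≫ (α_ _ _ _).hom ≫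
        G.map h ◁ (comm h').hom ≫ (comm h).hom) : PseudoCocone G.toPseudo a where
  ι i := ι i.as
  comm f := comm (leOfHom f.as)
  comm_naturality _ := (congrArg (· ≫ _) (id_whiskerRight _ _)).trans (Category.id_comp _)
  comm_id i := comm_id i.as
  comm_comp f g := comm_comp (leOfHom f.as) (leOfHom g.as)

section

variable {G : Chain Y K} {a : C} (c : PseudoCocone G.toPseudo a)

/-- The components of a cocone on a chain. -/
def leg (c : PseudoCocone G.toPseudo a) (i : K) : G.obj i ⟶ a := c.ι ⟨i⟩

/-- The 2-cells of a cocone on a chain. -/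
def tri (c : PseudoCocone G.toPseudo a) {i j : K} (h : i ≤ j) : G.map h ≫ leg c j ≅ leg c i :=
  c.comm (homOfLE h).toLoc

theorem tri_id (i : K) : (tri c (le_refl i)).hom = (G.mapId i).hom ▷ leg c i ≫ (λ_ _).hom :=
  c.comm_id ⟨i⟩

theorem tri_comp {i j k : K} (h : i ≤ j) (h' : j ≤ k) :
    (tri c (h.trans h')).hom = (G.mapComp h h').hom ▷ leg c k ≫ (α_ _ _ _).hom ≫
      G.map h ◁ (tri c h').hom ≫ (tri c h).hom :=
  c.comm_comp (homOfLE h).toLoc (homOfLE h').toLoc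

/-- Restriction of a cocone along a monotone map. -/
def pullCocone (c : PseudoCocone G.toPseudo a) (e : K' →o K) :
    PseudoCocone (G.pull e).toPseudo a :=
  (G.pull e).mkCocone (fun i => leg c (e i)) (fun h => tri c (e.monotone h))
    (fun i => tri_id c (e i)) (fun h h' => tri_comp c (e.monotone h) (e.monotone h'))

end

/-- The augmentation, as a cocone. -/
def augCocone (G : Chain Y K) : PseudoCocone G.toPseudo Y :=
  G.mkCocone G.aug G.augComp G.cells.aug_id G.cells.aug_comp

/-- The canonical cocone whose vertex is the value at an upper bound `j`. -/
def coconeOf (G : Chain Y K) (e : K' →o K) (j : K) (hj : ∀ k, e k ≤ j) :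
    PseudoCocone (G.pull e).toPseudo (G.obj j) :=
  (G.pull e).mkCocone (fun i => G.map (hj i))
    (fun {i i'} h => (G.mapComp (e.monotone h) (hj i')).symm)
    (fun i => by
      have := G.cells.left_unit (hj i)
      exact (Category.comp_id _).symm.trans ((Iso.inv_comp_eq _).2 this.symm))
    (fun {i i' i''} h h' => inv_eq_of_assoc _ _ _ _
      (G.cells.assoc (e.monotone h) (e.monotone h') (hj i'')))

end Chain

end Chains

end TwoOne

namespace TwoOne

/-! ### Isomorphisms and reindexing of cocones. -/

section Cocones

variable {C : Type u₂} [Bicategory.{w₂, v₂} C]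

namespace PseudoCocone

variable {K : Type u₁} [Bicategory.{w₁, v₁} K] {F : K ⥤ᵖ C} {a b : C}

theorem homFunctor_ext {X Y : PseudoCocone F a} {f g : X ⟶ Y} (h : ∀ i, f.app i = g.app i) :
    f = g :=
  Hom.ext (funext h)

/-- A modification with invertible components is an isomorphism. -/
def isoMk {c d : PseudoCocone F a} (φ : ∀ i, c.ι i ≅ d.ι i)
    (h : ∀ {i j : K} (f : i ⟶ j),
      F.map f ◁ (φ j).hom ≫ (d.comm f).hom = (c.comm f).hom ≫ (φ i).hom) : c ≅ d where
  hom := { app := fun i => (φ i).hom, naturality := h }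
  inv :=
    { app := fun i => (φ i).inv
      naturality := fun {i j} f => by
        rw [Iso.eq_comp_inv, Category.assoc, ← h f, whiskerLeft_inv_hom_assoc] }
  hom_inv_id := homFunctor_ext fun i => (φ i).hom_inv_id
  inv_hom_id := homFunctor_ext fun i => (φ i).inv_hom_id

/-- The components of an isomorphism of cocones. -/
def isoApp {c d : PseudoCocone F a} (e : c ≅ d) (i : K) : c.ι i ≅ d.ι i where
  hom := e.hom.app i
  inv := e.inv.app i
  hom_inv_id := congrFun (congrArg Hom.app e.hom_inv_id) i
  inv_hom_id := congrFun (congrArg Hom.app e.inv_hom_id) i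

theorem isoApp_naturality {c d : PseudoCocone F a} (e : c ≅ d) {i j : K} (f : i ⟶ j) :
    F.map f ◁ (isoApp e j).hom ≫ (d.comm f).hom = (c.comm f).hom ≫ (isoApp e i).hom :=
  e.hom.naturality f

end PseudoCocone

namespace Chain

variable {Y : C} {K : Type u₁} [Preorder K] {K' : Type u₃} [Preorder K']
  {G : Chain Y K} {a b : C}

/-- A modification between cocones on a chain, from its underlying data. -/
def mkHom {c d : PseudoCocone G.toPseudo a} (φ : ∀ i, leg c i ⟶ leg d i)
    (h : ∀ {i j : K} (h : i ≤ j), G.map h ◁ φ j ≫ (tri d h).hom = (tri c h).hom ≫ φ i) :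
    c ⟶ d where
  app i := φ i.as
  naturality f := h (leOfHom f.as)

/-- An invertible modification between cocones on a chain, from its underlying data. -/
def mkIso {c d : PseudoCocone G.toPseudo a} (φ : ∀ i, leg c i ≅ leg d i)
    (h : ∀ {i j : K} (h : i ≤ j),
      G.map h ◁ (φ j).hom ≫ (tri d h).hom = (tri c h).hom ≫ (φ i).hom) : c ≅ d :=
  PseudoCocone.isoMk (fun i => φ i.as) fun f => h (leOfHom f.as)

/-- Restriction of cocones along a monotone map, as a functor. -/
def pullFunctor (G : Chain Y K) (e : K' →o K) (b : C) :
    PseudoCocone G.toPseudo b ⥤ PseudoCocone (G.pull e).toPseudo b where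
  obj c := pullCocone c e
  map θ :=
    { app := fun k => θ.app ⟨e k.as⟩
      naturality := fun f => θ.naturality (homOfLE (e.monotone (leOfHom f.as))).toLoc }
  map_id _ := rfl
  map_comp _ _ := rfl

/-- Replaces transport along `e`: data given at the indices `e k` extend to all of `K` with a plain
equation on values, so no casts enter the coherence conditions. -/
theorem exists_lift {K' K : Type*} (e : K' ≃ K) (P : K → Sort*) (f : ∀ k, P (e k)) :
    ∃ g : ∀ i, P i, (fun k => g (e k)) = f :=
  ⟨Equiv.piCongrLeft P e f, funext fun k => Equiv.piCongrLeft_apply_apply P e f k⟩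

instance pullFunctor_isEquivalence (G : Chain Y K) (e : K' ≃o K) (b : C) :
    (G.pullFunctor (e : K' →o K) b).IsEquivalence where
  faithful := ⟨fun {c d} f g h => PseudoCocone.homFunctor_ext fun i => by
    obtain ⟨k, hk⟩ := e.surjective i.as
    obtain rfl : i = ⟨e k⟩ := congrArg LocallyDiscrete.mk hk.symm
    exact congrFun (congrArg PseudoCocone.Hom.app h) ⟨k⟩⟩
  full := ⟨fun {c d} f => by
    obtain ⟨φ, hφ⟩ := exists_lift e.toEquiv (fun i => leg c i ⟶ leg d i) (fun k => f.app ⟨k⟩)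
    refine ⟨mkHom φ ?_, PseudoCocone.homFunctor_ext fun i => congrFun hφ i.as⟩
    intro i j h
    obtain ⟨k, rfl⟩ := e.surjective i
    obtain ⟨l, rfl⟩ := e.surjective j
    have hk : φ (e k) = f.app ⟨k⟩ := congrFun hφ k
    have hl : φ (e l) = f.app ⟨l⟩ := congrFun hφ l
    rw [hk, hl]
    exact f.naturality (homOfLE (e.le_iff_le.1 h)).toLoc⟩
  essSurj := ⟨fun d => by
    obtain ⟨ι', comm', nat', id', comp'⟩ := d
    obtain ⟨ι, rfl⟩ := exists_lift (LocallyDiscrete.locallyDiscreteEquiv.trans e.toEquiv)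
      (fun i => G.obj i ⟶ b) ι'
    -- The 2-cells depend on two indices and are lifted in two turns: over the source, with the
    -- target still of the form `e l`, then over the target.
    obtain ⟨q, hq⟩ := exists_lift e.toEquiv
      (fun i => ∀ l (h : i ≤ e l), G.map h ≫ ι (e l) ≅ ι i)
      (fun k l h => comm' (homOfLE (e.le_iff_le.1 h) : k ⟶ l).toLoc)
    choose comm hcomm using fun i => exists_lift e.toEquiv
      (fun j => ∀ h : i ≤ j, G.map h ≫ ι j ≅ ι i) (fun l h => q i l h)
    have key : ∀ {k l : K'} (h : e k ≤ e l),
        comm (e k) (e l) h = comm' (homOfLE (e.le_iff_le.1 h) : k ⟶ l).toLoc := by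
      intro k l h
      exact (congrFun (congrFun (hcomm (e k)) l) h).trans (congrFun (congrFun (congrFun hq k) l) h)
    refine ⟨G.mkCocone ι (fun {i j} h => comm i j h) ?_ ?_, ⟨?_⟩⟩
    · intro i
      obtain ⟨k, rfl⟩ := e.surjective i
      rw [key]
      exact id' ⟨k⟩
    · intro i i' i'' h h'
      obtain ⟨k, rfl⟩ := e.surjective i
      obtain ⟨k', rfl⟩ := e.surjective i'
      obtain ⟨k'', rfl⟩ := e.surjective i''
      rw [key, key, key]
      exact comp' (homOfLE (e.le_iff_le.1 h) : k ⟶ k').toLoc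
        (homOfLE (e.le_iff_le.1 h') : k' ⟶ k'').toLoc
    · refine mkIso (fun _ => Iso.refl _) fun {k l} h => ?_
      refine (congrArg (· ≫ _) (whiskerLeft_id _ _)).trans
        ((Category.id_comp _).trans (Eq.trans ?_ (Category.comp_id _).symm))
      exact (congrArg Iso.hom (key (e.monotone h))).symm⟩

/-- A cocone is a 2-colimit if and only if its reindexing along an order isomorphism is. -/
theorem isColimit_pullCocone_iff (c : PseudoCocone G.toPseudo a) (e : K' ≃o K) :
    (pullCocone c (e : K' →o K)).IsColimit ↔ c.IsColimit := by
  refine forall_congr' fun b => ?_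
  have h : (pullCocone c (e : K' →o K)).homFunctor b = c.homFunctor b ⋙
    G.pullFunctor (e : K' →o K) b := rfl
  rw [h]
  exact ⟨fun _ => Functor.isEquivalence_of_comp_right _ (G.pullFunctor (e : K' →o K) b),
    fun _ => inferInstance⟩

end Chain

end Cocones

end TwoOne

namespace TwoOne

/-! ### Restriction to initial segments, and shapes with a largest element. -/

section

variable {C : Type u₂} [Bicategory.{w₂, v₂} C]

namespace Chain

variable {Y : C} {K : Type u₁} [Preorder K] {a b : C}

section Restrict

variable {J : Type u₁} [LinearOrder J]

/-- The inclusion of the indices below `j`. -/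
def inclIio (j : J) : Set.Iio j →o J := ⟨Subtype.val, Subtype.mono_coe _⟩

/-- The canonical cocone with vertex the value at `j` on the restriction to the indices
below `j`. -/
def coconeBelow (G : Chain Y J) (j : J) :
    PseudoCocone (G.pull (inclIio j)).toPseudo (G.obj j) :=
  G.coconeOf (inclIio j) j fun i => le_of_lt i.2

/-- The constraints of a composite pseudofunctor carry an extra factor `F.map₂` of an identity. It
disappears only after rewriting, which is why `restrict` and `pull` have to be compared by an
equivalence. -/
theorem restrict_mapId (F : LocallyDiscrete J ⥤ᵖ C) (j : J) (i : LocallyDiscrete (Set.Iio j)) :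
    ((restrict F j).mapId i).hom = (F.mapId ⟨i.as.1⟩).hom :=
  (congrArg (· ≫ (F.mapId ⟨i.as.1⟩).hom) (F.map₂_id _)).trans (Category.id_comp _)

theorem restrict_mapComp (F : LocallyDiscrete J ⥤ᵖ C) (j : J)
    {i i' i'' : LocallyDiscrete (Set.Iio j)} (f : i ⟶ i') (g : i' ⟶ i'') :
    ((restrict F j).mapComp f g).hom = (F.mapComp
        (homOfLE (leOfHom f.as) : i.as.1 ⟶ i'.as.1).toLoc
        (homOfLE (leOfHom g.as) : i'.as.1 ⟶ i''.as.1).toLoc).hom :=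
  (congrArg (· ≫ _) (F.map₂_id _)).trans (Category.id_comp _)

/-- Cocones on the restriction of the pseudofunctor of a chain, seen as cocones on the restricted
chain. -/
def restrictFunctor (G : Chain Y J) (j : J) (b : C) :
    PseudoCocone (restrict G.toPseudo j) b ⥤ PseudoCocone (G.pull (inclIio j)).toPseudo b where
  obj c := (G.pull (inclIio j)).mkCocone (fun i => c.ι ⟨i⟩) (fun h => c.comm (homOfLE h).toLoc)
    (fun i => (c.comm_id ⟨i⟩).trans (congrArg (· ▷ _ ≫ _) (restrict_mapId G.toPseudo j ⟨i⟩)))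
    (fun h h' => (c.comm_comp (homOfLE h).toLoc (homOfLE h').toLoc).trans
      (congrArg (· ▷ _ ≫ _) (restrict_mapComp G.toPseudo j (homOfLE h).toLoc (homOfLE h').toLoc)))
  map θ :=
    { app := fun i => θ.app i
      naturality := fun f => θ.naturality f }
  map_id _ := rfl
  map_comp _ _ := rfl

instance (G : Chain Y J) (j : J) (b : C) : (G.restrictFunctor j b).IsEquivalence where
  faithful := ⟨fun h => PseudoCocone.homFunctor_ext fun i =>
    congrFun (congrArg PseudoCocone.Hom.app h) i⟩
  full := ⟨fun f =>
    ⟨{ app := fun i => f.app i, naturality := fun g => f.naturality g }, rfl⟩⟩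
  essSurj := ⟨fun d =>
    ⟨{  ι := d.ι
        comm := d.comm
        comm_naturality := fun η => d.comm_naturality η
        comm_id := fun i => (d.comm_id i).trans
          (congrArg (· ▷ _ ≫ _) (restrict_mapId G.toPseudo j i)).symm
        comm_comp := fun f g => (d.comm_comp f g).trans
          (congrArg (· ▷ _ ≫ _) (restrict_mapComp G.toPseudo j f g)).symm },
      ⟨Iso.refl _⟩⟩⟩

theorem isColimit_coconeAt (G : Chain Y J) (j : J) (h : (G.coconeBelow j).IsColimit) :
    (coconeAt G.toPseudo j).IsColimit := by
  intro b
  have : ((coconeAt G.toPseudo j).homFunctor b ⋙ G.restrictFunctor j b).IsEquivalence := h b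
  exact Functor.isEquivalence_of_comp_right _ (G.restrictFunctor j b)

end Restrict

section Top

/-- Whiskering by an endo-1-cell isomorphic to the identity is conjugate to the identity functor.
This is its fullness; the next lemma is its faithfulness. -/
theorem whiskerLeft_conj {x : C} {E : x ⟶ x} (e : E ≅ 𝟙 x) {r s : x ⟶ b} (φ : E ≫ r ⟶ E ≫ s) :
    E ◁ ((λ_ r).inv ≫ e.inv ▷ r ≫ φ ≫ e.hom ▷ s ≫ (λ_ s).hom) = φ := by
  have key : ∀ η : r ⟶ s, E ◁ η ≫ e.hom ▷ s ≫ (λ_ s).hom = e.hom ▷ r ≫ (λ_ r).hom ≫ η := by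
    intro η
    rw [whisker_exchange_assoc, leftUnitor_naturality]
  rw [← cancel_mono (e.hom ▷ s ≫ (λ_ s).hom), key]
  simp

theorem whiskerLeft_injective {x : C} {E : x ⟶ x} (e : E ≅ 𝟙 x) {r s : x ⟶ b} {η θ : r ⟶ s}
    (h : E ◁ η = E ◁ θ) : η = θ := by
  have key : ∀ η : r ⟶ s,
      (λ_ r).inv ≫ e.inv ▷ r ≫ E ◁ η ≫ e.hom ▷ s ≫ (λ_ s).hom = η := by
    intro η
    rw [whisker_exchange_assoc, leftUnitor_naturality]
    simp
  rw [← key η, h, key]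

/-- The canonical cocone whose vertex is the value at a largest element. -/
def coconeTop (G : Chain Y K) (t : K) (ht : ∀ i, i ≤ t) : PseudoCocone G.toPseudo (G.obj t) :=
  G.coconeOf OrderHom.id t ht

/-- A largest index is terminal, so a cocone is recovered from its leg at `t`. The transition from
`t` to itself is only isomorphic to the identity, hence the conjugation by `G.mapId t`. -/
theorem isColimit_coconeTop (G : Chain Y K) (t : K) (ht : ∀ i, i ≤ t) :
    (G.coconeTop t ht).IsColimit := fun b =>
  { faithful := ⟨fun {r s} η θ h =>
      whiskerLeft_injective (G.mapId t) (congrFun (congrArg PseudoCocone.Hom.app h) ⟨t⟩)⟩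
    full := ⟨fun {r s} φ => by
      let φt : G.map (le_refl t) ≫ r ⟶ G.map (le_refl t) ≫ s := φ.app ⟨t⟩
      let η : r ⟶ s := (λ_ r).inv ≫ (G.mapId t).inv ▷ r ≫ φt ≫ (G.mapId t).hom ▷ s ≫ (λ_ s).hom
      refine ⟨η, PseudoCocone.homFunctor_ext fun i => ?_⟩
      let ψ := ((G.coconeTop t ht).homFunctor b).map η
      have h₁ := φ.naturality (homOfLE (ht i.as)).toLoc
      have h₂ := ψ.naturality (homOfLE (ht i.as)).toLoc
      have h₃ : ψ.app ⟨t⟩ = φ.app ⟨t⟩ := whiskerLeft_conj (G.mapId t) φt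
      rw [h₃] at h₂
      exact (cancel_epi _).1 (h₂.symm.trans h₁)⟩
    essSurj := ⟨fun d => ⟨leg d t, ⟨mkIso (fun i => tri d (ht i)) fun {i j} h => by
      have h₁ := tri_comp d h (ht j)
      change G.map h ◁ (tri d (ht j)).hom ≫ (tri d h).hom =
        ((α_ _ _ _).inv ≫ (G.mapComp h (ht j)).inv ▷ leg d t) ≫ (tri d (ht i)).hom
      rw [h₁]
      simp⟩⟩⟩ }

end Top

end Chain

end

end TwoOne

namespace TwoOne

/-! ### Strictification of pseudofunctors on small preorders. -/

section Strictification

variable {C : Type u} [Bicategory.{v, v} C] {Y : C} {K : Type v} [Preorder K]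

theorem eq_of_left_unit {x y : C} {E : x ⟶ x} {m : x ⟶ y} (e : E ≅ 𝟙 x) (γ : m ≅ E ≫ m)
    (h : γ.hom ≫ e.hom ▷ m ≫ (λ_ m).hom = 𝟙 _) : γ.inv = e.hom ▷ m ≫ (λ_ m).hom :=
  (Category.comp_id _).symm.trans ((Iso.inv_comp_eq _).2 h.symm)

theorem eq_of_right_unit {x y : C} {E : y ⟶ y} {m : x ⟶ y} (e : E ≅ 𝟙 y) (γ : m ≅ m ≫ E)
    (h : γ.hom ≫ m ◁ e.hom ≫ (ρ_ m).hom = 𝟙 _) : γ.inv = m ◁ e.hom ≫ (ρ_ m).hom :=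
  (Category.comp_id _).symm.trans ((Iso.inv_comp_eq _).2 h.symm)

theorem str_assoc {a b c d : C} {x f : a ⟶ b} {y g : b ⟶ c} {z h : c ⟶ d} {p : a ⟶ c}
    {q : b ⟶ d} {m : a ⟶ d} (φ : f ⟶ x) (ψ : g ⟶ y) (χ : h ⟶ z) (A : m ≅ p ≫ z)
    (β : p ≅ x ≫ y) (γ : m ≅ x ≫ q) (δ : q ≅ y ≫ z)
    (w : A.inv = β.hom ▷ z ≫ (α_ x y z).hom ≫ x ◁ δ.inv ≫ γ.inv) :
    (φ ▷ g ≫ x ◁ ψ ≫ β.inv) ▷ h ≫ p ◁ χ ≫ A.inv =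
      (α_ f g h).hom ≫ φ ▷ (g ≫ h) ≫ x ◁ (ψ ▷ h ≫ y ◁ χ ≫ δ.inv) ≫ γ.inv := by
  rw [w]
  have h₁ : β.inv ▷ h ≫ p ◁ χ ≫ β.hom ▷ z = (x ≫ y) ◁ χ := by
    rw [whisker_exchange, inv_hom_whiskerRight_assoc]
  simp only [comp_whiskerRight, Category.assoc, whiskerLeft_comp]
  rw [reassoc_of% h₁]
  simp

theorem str_whiskerLeft {a b c : C} {x f : a ⟶ b} {y g g' : b ⟶ c} {m : a ⟶ c} (φ : f ≅ x)
    (ψ : g ≅ y) (ψ' : g' ≅ y) (γ : x ≫ y ≅ m) :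
    (whiskerRightIso φ g ≪≫ whiskerLeftIso x ψ ≪≫ γ).hom ≫
      (whiskerRightIso φ g' ≪≫ whiskerLeftIso x ψ' ≪≫ γ).inv = f ◁ (ψ.hom ≫ ψ'.inv) := by
  simp only [Iso.trans_hom, whiskerRightIso_hom, whiskerLeftIso_hom, Iso.trans_inv,
    whiskerRightIso_inv, whiskerLeftIso_inv, Category.assoc, Iso.hom_inv_id_assoc]
  rw [← whiskerLeft_comp_assoc, ← whisker_exchange_assoc, hom_inv_whiskerRight, Category.comp_id]

theorem str_whiskerRight {a b c : C} {x f f' : a ⟶ b} {y g : b ⟶ c} {m : a ⟶ c} (φ : f ≅ x)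
    (φ' : f' ≅ x) (ψ : g ≅ y) (γ : x ≫ y ≅ m) :
    (whiskerRightIso φ g ≪≫ whiskerLeftIso x ψ ≪≫ γ).hom ≫
      (whiskerRightIso φ' g ≪≫ whiskerLeftIso x ψ ≪≫ γ).inv = (φ.hom ≫ φ'.inv) ▷ g := by
  simp

/-- The objects of the strict (2,1)-category that classifies the pseudofunctor underlying `G`. -/
structure Str (G : Chain Y K) where
  as : K

namespace Str

variable {G : Chain Y K}

/-- The 1-cells of the classifier: 1-cells of `C` that are identified with a transition map. -/
structure Hom (x y : Str G) where
  hle : x.as ≤ y.as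
  cell : G.obj x.as ⟶ G.obj y.as
  iso : cell ≅ G.map hle

theorem Hom.ext_of {x y : Str G} {p q : Hom x y} (h : p.cell = q.cell)
    (h' : p.iso.hom = eqToHom h ≫ q.iso.hom) : p = q := by
  obtain ⟨_, f, φ⟩ := p
  obtain ⟨_, g, ψ⟩ := q
  obtain rfl : f = g := h
  obtain rfl : φ = ψ := Iso.ext (h'.trans (Category.id_comp _))
  rfl

/-- The 2-cells of the classifier are trivial. -/
instance (x y : Str G) : Category.{v} (Hom x y) where
  Hom _ _ := PUnit.{v + 1}
  id _ := ⟨⟩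
  comp _ _ := ⟨⟩

/-- Any two parallel 1-cells of the classifier are isomorphic. -/
def isoOf {x y : Str G} (p q : Hom x y) : p ≅ q where
  hom := PUnit.unit
  inv := PUnit.unit

/-- The 2-cells carry no data because parallel 1-cells are identified with the same transition map,
which already singles out a comparison in `C`. Composition pastes these identifications with the
constraints of `G`. -/
instance : Bicategory.{v, v} (Str G) where
  Hom := Hom
  id x := ⟨le_rfl, 𝟙 _, (G.mapId x.as).symm⟩
  comp p q := ⟨p.hle.trans q.hle, p.cell ≫ q.cell, whiskerRightIso p.iso q.cell ≪≫
    whiskerLeftIso (G.map p.hle) q.iso ≪≫ (G.mapComp p.hle q.hle).symm⟩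
  homCategory x y := inferInstanceAs (Category (Hom x y))
  whiskerLeft _ _ _ _ := PUnit.unit
  whiskerRight _ _ := PUnit.unit
  associator _ _ _ := isoOf _ _
  leftUnitor _ := isoOf _ _
  rightUnitor _ := isoOf _ _

instance subsingleton_hom₂ {x y : Str G} (p q : x ⟶ y) : Subsingleton (p ⟶ q) :=
  inferInstanceAs (Subsingleton PUnit.{v + 1})

instance : IsLocallyGroupoid (Str G) := fun _ _ =>
  ⟨fun _ => ⟨PUnit.unit, Subsingleton.elim _ _, Subsingleton.elim _ _⟩⟩

variable [Bicategory.Strict C]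

/-- Strictness of `C` equates the underlying 1-cells, the comparison `eqToHom` being a unitor; the
unit axiom of the chain then matches the identifications with transition maps. The other two laws go
the same way. -/
theorem id_comp_aux {x y : Str G} (p : x ⟶ y) : 𝟙 x ≫ p = p := by
  refine Hom.ext_of (Strict.id_comp _) ?_
  have h : eqToHom (Strict.id_comp p.cell) = (λ_ p.cell).hom := by
    rw [Strict.leftUnitor_eqToIso]; rfl
  erw [h]
  change (G.mapId x.as).inv ▷ p.cell ≫ G.map _ ◁ p.iso.hom ≫ (G.mapComp _ _).inv =
    (λ_ p.cell).hom ≫ p.iso.hom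
  have h₁ := G.cells.left_unit p.hle
  rw [eq_of_left_unit _ _ h₁, whisker_exchange_assoc]
  simp

theorem comp_id_aux {x y : Str G} (p : x ⟶ y) : p ≫ 𝟙 y = p := by
  refine Hom.ext_of (Strict.comp_id _) ?_
  have h : eqToHom (Strict.comp_id p.cell) = (ρ_ p.cell).hom := by
    rw [Strict.rightUnitor_eqToIso]; rfl
  erw [h]
  change p.iso.hom ▷ _ ≫ G.map _ ◁ (G.mapId y.as).inv ≫ (G.mapComp _ _).inv =
    (ρ_ p.cell).hom ≫ p.iso.hom
  have h₁ := G.cells.right_unit p.hle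
  rw [eq_of_right_unit _ _ h₁]
  simp

theorem assoc_aux {x y z w : Str G} (p : x ⟶ y) (q : y ⟶ z) (r : z ⟶ w) :
    (p ≫ q) ≫ r = p ≫ q ≫ r := by
  refine Hom.ext_of (Strict.assoc _ _ _) ?_
  have h : eqToHom (Strict.assoc p.cell q.cell r.cell) = (α_ p.cell q.cell r.cell).hom := by
    rw [Strict.associator_eqToIso]; rfl
  erw [h]
  change (p.iso.hom ▷ _ ≫ G.map _ ◁ q.iso.hom ≫ (G.mapComp _ _).inv) ▷ _ ≫ G.map _ ◁ r.iso.hom ≫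
      (G.mapComp _ _).inv =
    (α_ p.cell q.cell r.cell).hom ≫ p.iso.hom ▷ _ ≫
      G.map _ ◁ (q.iso.hom ▷ _ ≫ G.map _ ◁ r.iso.hom ≫ (G.mapComp _ _).inv) ≫ (G.mapComp _ _).inv
  have h₁ := inv_eq_of_assoc _ _ _ _ (G.cells.assoc p.hle q.hle r.hle)
  exact str_assoc _ _ _ _ _ _ _ h₁

instance : Bicategory.Strict (Str G) where
  id_comp := id_comp_aux
  comp_id := comp_id_aux
  assoc := assoc_aux
  leftUnitor_eqToIso _ := Iso.ext (Subsingleton.elim _ _)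
  rightUnitor_eqToIso _ := Iso.ext (Subsingleton.elim _ _)
  associator_eqToIso _ _ _ := Iso.ext (Subsingleton.elim _ _)

/-- The strict 2-functor on the classifier that corresponds to the pseudofunctor of `G`. -/
def functor (G : Chain Y K) : StrictPseudofunctor (Str G) C :=
  StrictPseudofunctor.mk''
    { obj := fun x => G.obj x.as
      map := fun p => p.cell
      map₂ := fun {_ _ p q} _ => p.iso.hom ≫ q.iso.inv
      map₂_id := fun _ => Iso.hom_inv_id _
      map₂_comp := fun {_ _ p q r} _ _ => by
        simp
      map_id := fun _ => rfl
      map_comp := fun _ _ => rfl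
      map₂_whisker_left := fun {_ _ _} f {g g'} _ => by
        refine Eq.trans ?_ (Eq.trans (Category.comp_id _).symm (Category.id_comp _).symm)
        exact str_whiskerLeft f.iso g.iso g'.iso (G.mapComp f.hle g.hle).symm
      map₂_whisker_right := fun {_ _ _ f f'} _ g => by
        refine Eq.trans ?_ (Eq.trans (Category.comp_id _).symm (Category.id_comp _).symm)
        exact str_whiskerRight f.iso f'.iso g.iso (G.mapComp f.hle g.hle).symm }

/-- The 1-cell of the classifier given by a transition map. -/
def gen {x y : Str G} (h : x.as ≤ y.as) : x ⟶ y :=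
  Hom.mk h (G.map h) (Iso.refl _)

section

variable {b : C} (c : PseudoCocone (functor G).toPseudofunctor b)

/-- The components of a cocone on the strict 2-functor. -/
def leg (x : Str G) : G.obj x.as ⟶ b := c.ι x

/-- The 2-cells of a cocone on the strict 2-functor. -/
def tri {x y : Str G} (p : x ⟶ y) : p.cell ≫ leg c y ≅ leg c x := c.comm p

/-- The 2-cells of a cocone on the strict 2-functor at the transition maps. -/
def triGen {x y : Str G} (h : x.as ≤ y.as) : G.map h ≫ leg c y ≅ leg c x := c.comm (gen h)

/-- Naturality against the unique 2-cell from `p` to the transition map: a cocone on the strict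
2-functor is determined by its values at the transition maps. -/
theorem tri_eq {x y : Str G} (p : x ⟶ y) :
    (tri c p).hom = p.iso.hom ▷ leg c y ≫ (triGen c p.hle).hom := by
  have h : (p.iso.hom ≫ 𝟙 (G.map p.hle)) ▷ leg c y ≫ (triGen c p.hle).hom = (tri c p).hom :=
    c.comm_naturality (f := p) (g := gen p.hle) PUnit.unit
  rw [Category.comp_id] at h
  exact h.symm

theorem triGen_eq {x y : Str G} (p : x ⟶ y) :
    (triGen c p.hle).hom = p.iso.inv ▷ leg c y ≫ (tri c p).hom := by
  rw [tri_eq, inv_hom_whiskerRight_assoc]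

theorem tri_id (x : Str G) : (tri c (𝟙 x)).hom = (λ_ (leg c x)).hom :=
  (c.comm_id x).trans ((congrArg (· ≫ _) (id_whiskerRight _ _)).trans (Category.id_comp _))

theorem tri_comp {x y z : Str G} (p : x ⟶ y) (q : y ⟶ z) :
    (tri c (p ≫ q)).hom = (α_ p.cell q.cell (leg c z)).hom ≫
      p.cell ◁ (tri c q).hom ≫ (tri c p).hom :=
  (c.comm_comp p q).trans ((congrArg (· ≫ _) (id_whiskerRight _ _)).trans (Category.id_comp _))

theorem triGen_id (x : Str G) :
    (triGen c (le_refl x.as)).hom = (G.mapId x.as).hom ▷ leg c x ≫ (λ_ (leg c x)).hom :=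
  (triGen_eq c (𝟙 x)).trans (congrArg (_ ≫ ·) (tri_id c x))

theorem triGen_comp {x y z : Str G} (h : x.as ≤ y.as) (h' : y.as ≤ z.as) :
    (triGen c (h.trans h')).hom = (G.mapComp h h').hom ▷ leg c z ≫ (α_ _ _ _).hom ≫
      G.map h ◁ (triGen c h').hom ≫ (triGen c h).hom := by
  refine (triGen_eq c (gen h ≫ gen h')).trans ?_
  rw [tri_comp]
  refine congrArg (· ▷ leg c z ≫ _) ?_
  change ((G.mapComp h h').hom ≫ G.map h ◁ 𝟙 _) ≫ 𝟙 _ ▷ G.map h' = (G.mapComp h h').hom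
  simp

end

/-- Cocones on the strict 2-functor, seen as cocones on the pseudofunctor. -/
def toChainCocone (G : Chain Y K) (b : C) :
    PseudoCocone (functor G).toPseudofunctor b ⥤ PseudoCocone G.toPseudo b where
  obj c := G.mkCocone (fun i => leg c ⟨i⟩) (fun {i j} h => triGen c (x := ⟨i⟩) (y := ⟨j⟩) h)
    (fun i => triGen_id c ⟨i⟩) (fun {i j k} => triGen_comp c (x := ⟨i⟩) (y := ⟨j⟩) (z := ⟨k⟩))
  map θ :=
    { app := fun i => θ.app ⟨i.as⟩
      naturality := fun {i j} f =>
        θ.naturality (gen (x := ⟨i.as⟩) (y := ⟨j.as⟩) (leOfHom f.as)) }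
  map_id _ := rfl
  map_comp _ _ := rfl

/-- Cocones on the pseudofunctor, seen as cocones on the strict 2-functor. -/
def ofChainCocone {b : C} (d : PseudoCocone G.toPseudo b) :
    PseudoCocone (functor G).toPseudofunctor b where
  ι x := Chain.leg d x.as
  comm {x y} p := whiskerRightIso p.iso (Chain.leg d y.as) ≪≫ Chain.tri d p.hle
  comm_naturality {x y p q} η := by
    change (p.iso.hom ≫ q.iso.inv) ▷ Chain.leg d y.as ≫ q.iso.hom ▷ Chain.leg d y.as ≫
      (Chain.tri d q.hle).hom =
      p.iso.hom ▷ Chain.leg d y.as ≫ (Chain.tri d p.hle).hom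
    simp
  comm_id x := by
    change (G.mapId x.as).inv ▷ Chain.leg d x.as ≫ (Chain.tri d (le_refl x.as)).hom =
      𝟙 _ ▷ Chain.leg d x.as ≫ (λ_ _).hom
    rw [Chain.tri_id]
    simp
  comm_comp {x y z} p q := by
    change (p.iso.hom ▷ _ ≫ G.map p.hle ◁ q.iso.hom ≫ (G.mapComp p.hle q.hle).inv) ▷
      Chain.leg d z.as ≫
        (Chain.tri d (p.hle.trans q.hle)).hom = 𝟙 _ ▷ Chain.leg d z.as ≫ (α_ _ _ _).hom ≫
      p.cell ◁ (q.iso.hom ▷ Chain.leg d z.as ≫ (Chain.tri d q.hle).hom) ≫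
        p.iso.hom ▷ Chain.leg d y.as ≫ (Chain.tri d p.hle).hom
    rw [Chain.tri_comp d p.hle q.hle]
    simp only [comp_whiskerRight, Category.assoc, inv_hom_whiskerRight_assoc, whisker_assoc,
      id_whiskerRight, Category.id_comp, whiskerLeft_comp, Iso.inv_hom_id_assoc]
    rw [associator_naturality_left_assoc, ← whisker_exchange_assoc, ← whisker_exchange_assoc]

instance (G : Chain Y K) (b : C) : (toChainCocone G b).IsEquivalence where
  faithful := ⟨fun h => PseudoCocone.homFunctor_ext fun x =>
    congrFun (congrArg PseudoCocone.Hom.app h) ⟨x.as⟩⟩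
  full := ⟨fun {c d} f => by
    refine ⟨{ app := fun x => f.app ⟨x.as⟩, naturality := fun {x y} p => ?_ }, rfl⟩
    let φ (x : Str G) : leg c x ⟶ leg d x := f.app ⟨x.as⟩
    have h : G.map p.hle ◁ φ y ≫ (triGen d p.hle).hom = (triGen c p.hle).hom ≫ φ x :=
      f.naturality (homOfLE p.hle).toLoc
    change p.cell ◁ φ y ≫ (tri d p).hom = (tri c p).hom ≫ φ x
    rw [tri_eq c p, tri_eq d p, whisker_exchange_assoc, h, Category.assoc]⟩
  essSurj := ⟨fun d => ⟨ofChainCocone d, ⟨Chain.mkIso (fun _ => Iso.refl _) fun {i j} h => by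
    change G.map h ◁ 𝟙 _ ≫ (Chain.tri d h).hom = (𝟙 _ ▷ _ ≫ (Chain.tri d h).hom) ≫ 𝟙 _
    simp⟩⟩⟩

end Str

/-- A 2-cocomplete strict (2,1)-category has 2-colimits of pseudofunctors from small
preorders. -/
theorem exists_isColimit_of_small [Bicategory.Strict C] (hC : TwoCocomplete C) (G : Chain Y K) :
    ∃ (a : C) (c : PseudoCocone G.toPseudo a), c.IsColimit := by
  -- The classifier is small enough: its objects come from `K` and its 1-cells from hom-types of
  -- `C`, all in `Type v`.
  obtain ⟨a, c, hc⟩ := hC (Str G) (Str.functor G)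
  refine ⟨a, (Str.toChainCocone G a).obj c, fun b => ?_⟩
  have := hc b
  exact inferInstanceAs (c.homFunctor b ⋙ Str.toChainCocone G b).IsEquivalence

end Strictification

end TwoOne

namespace TwoOne

/-! ### 2-pushouts as 2-colimits of strict spans. -/

section Pushouts

/-- The objects of the shape of a span. -/
inductive SpanShape : Type v
  | zero | left | right

namespace SpanShape

/-- The arrows of the shape of a span. -/
inductive Hom : SpanShape.{v} → SpanShape.{v} → Type v
  | id (x : SpanShape) : Hom x x
  | fst : Hom zero left
  | snd : Hom zero right

/-- Composition in the shape of a span. -/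
def Hom.comp : ∀ {x y z : SpanShape.{v}}, Hom x y → Hom y z → Hom x z
  | _, _, _, .id _, g => g
  | _, _, _, .fst, .id _ => .fst
  | _, _, _, .snd, .id _ => .snd

instance : Category.{v} SpanShape.{v} where
  Hom := Hom
  id := Hom.id
  comp := Hom.comp
  id_comp _ := rfl
  comp_id f := by cases f <;> rfl
  assoc f g h := by cases f <;> cases g <;> rfl

end SpanShape

variable {C : Type u} [Bicategory.{v, v} C] {A B X : C} (h : A ⟶ X) (g : A ⟶ B)

/-- A pair of compatible invertible 2-cells is an isomorphism of squares. -/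
def SpanCocone.isoMk {C : Type u₂} [Bicategory.{w₂, v₂} C] {A B X a : C} {h : A ⟶ X} {g : A ⟶ B}
    {s t : SpanCocone h g a} (l : s.inl ≅ t.inl) (r : s.inr ≅ t.inr)
    (w : h ◁ l.hom ≫ t.iso.hom = s.iso.hom ≫ g ◁ r.hom) : s ≅ t where
  hom := { left := l.hom, right := r.hom, w := w }
  inv :=
    { left := l.inv
      right := r.inv
      w := by
        rw [← cancel_epi (h ◁ l.hom), whiskerLeft_hom_inv_assoc, reassoc_of% w,
          whiskerLeft_hom_inv, Category.comp_id] }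
  hom_inv_id := SpanCocone.Hom.ext l.hom_inv_id r.hom_inv_id
  inv_hom_id := SpanCocone.Hom.ext l.inv_hom_id r.inv_hom_id

/-- Follows from `comm_id` alone, so a modification on a span needs checking only at its two
nonidentity arrows. -/
theorem PseudoCocone.naturality_id {C : Type u₂} [Bicategory.{w₂, v₂} C] {a : C} {K : Type u₁}
    [Bicategory.{w₁, v₁} K] {F : K ⥤ᵖ C} {c d : PseudoCocone F a}
    (i : K) (φ : c.ι i ⟶ d.ι i) :
    F.map (𝟙 i) ◁ φ ≫ (d.comm (𝟙 i)).hom = (c.comm (𝟙 i)).hom ≫ φ := by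
  rw [d.comm_id, c.comm_id, whisker_exchange_assoc, leftUnitor_naturality, Category.assoc]

/-- Eliminates the component `t` at the apex of a span, merging two naturality squares into the
condition on a pair of 2-cells. The next lemma goes back. -/
theorem comp_inv_eq_of_comp_eq {D : Type*} [Category D] {p q r p' q' r' : D} {l : p ⟶ p'}
    {t : q ⟶ q'} {m : r ⟶ r'} {c₁ : p ≅ q} {c₂ : r ≅ q} {d₁ : p' ≅ q'} {d₂ : r' ≅ q'}
    (h₁ : l ≫ d₁.hom = c₁.hom ≫ t) (h₂ : m ≫ d₂.hom = c₂.hom ≫ t) :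
    l ≫ d₁.hom ≫ d₂.inv = (c₁.hom ≫ c₂.inv) ≫ m := by
  rw [← Category.assoc, Iso.comp_inv_eq, Category.assoc, Category.assoc, h₂, h₁,
    Iso.inv_hom_id_assoc]

theorem eq_of_comp_inv_eq {D : Type*} [Category D] {p q r p' q' r' : D} {l : p ⟶ p'}
    {m : r ⟶ r'} {c₁ : p ≅ q} {c₂ : r ≅ q} {d₁ : p' ≅ q'} {d₂ : r' ≅ q'}
    (w : l ≫ d₁.hom ≫ d₂.inv = (c₁.hom ≫ c₂.inv) ≫ m) :
    m ≫ d₂.hom = c₂.hom ≫ c₁.inv ≫ l ≫ d₁.hom := by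
  rw [← Category.assoc, Iso.comp_inv_eq] at w
  simp [w]

theorem left_triangle_inv {C : Type u₂} [Bicategory.{w₂, v₂} C] {A B a : C} (h : A ⟶ B)
    {l : B ⟶ a} {m : A ⟶ a}
    (φ : h ≫ l ⟶ m) :
    φ = (ρ_ h).inv ▷ l ≫ (α_ h (𝟙 B) l).hom ≫ h ◁ (λ_ l).hom ≫ φ := by
  simp

namespace SpanShape

variable (A B X) in
/-- The objects of a span. -/
def obj : SpanShape.{v} → C
  | zero => A
  | left => X
  | right => B

/-- The 1-cells of a span. -/
def map : ∀ {x y : SpanShape.{v}}, Hom x y → (obj A B X x ⟶ obj A B X y)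
  | _, _, .id x => 𝟙 (obj A B X x)
  | _, _, .fst => h
  | _, _, .snd => g

variable [Bicategory.Strict C]

theorem map_comp {x y z : SpanShape.{v}} (p : Hom x y) (q : Hom y z) :
    map h g (p.comp q) = map h g p ≫ map h g q := by
  cases p
  · exact (Strict.id_comp _).symm
  · cases q
    exact (Strict.comp_id _).symm
  · cases q
    exact (Strict.comp_id _).symm

/-- A span, as a strict 2-functor. -/
def functor : StrictPseudofunctor (LocallyDiscrete SpanShape.{v}) C :=
  StrictPseudofunctor.mk''
    { obj := fun x => obj A B X x.as
      map := fun p => map h g p.as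
      map₂ := fun η => eqToHom (by rw [LocallyDiscrete.eq_of_hom η])
      map_id := fun _ => rfl
      map_comp := fun p q => map_comp h g p.as q.as
      map₂_whisker_left := fun p _ _ η => by
        obtain rfl := LocallyDiscrete.eq_of_hom η
        simp
      map₂_whisker_right := fun η p => by
        obtain rfl := LocallyDiscrete.eq_of_hom η
        simp }

variable {h g} {a : C}

section

variable {a : C} (c : PseudoCocone (functor h g).toPseudofunctor a)

/-- The component of a cocone on a span at the apex. -/
def legZero : A ⟶ a := c.ι ⟨zero⟩

/-- The component of a cocone on a span at the first foot. -/
def legLeft : X ⟶ a := c.ι ⟨left⟩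

/-- The component of a cocone on a span at the second foot. -/
def legRight : B ⟶ a := c.ι ⟨right⟩

/-- The 2-cell of a cocone on a span at the first arrow. -/
def triFst : h ≫ legLeft c ≅ legZero c := c.comm (i := ⟨zero⟩) (j := ⟨left⟩) ⟨.fst⟩

/-- The 2-cell of a cocone on a span at the second arrow. -/
def triSnd : g ≫ legRight c ≅ legZero c := c.comm (i := ⟨zero⟩) (j := ⟨right⟩) ⟨.snd⟩

end

/-- The span cocone underlying a cocone on the 2-functor given by a span. -/
def toSpanCocone (a : C) : PseudoCocone (functor h g).toPseudofunctor a ⥤ SpanCocone h g a where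
  obj c :=
    { inl := legLeft c
      inr := legRight c
      iso := triFst c ≪≫ (triSnd c).symm }
  map {c d} θ :=
    { left := θ.app ⟨left⟩
      right := θ.app ⟨right⟩
      w := comp_inv_eq_of_comp_eq (c₁ := triFst c) (c₂ := triSnd c) (d₁ := triFst d)
        (d₂ := triSnd d) (θ.naturality (i := ⟨zero⟩) (j := ⟨left⟩) ⟨.fst⟩)
        (θ.naturality (i := ⟨zero⟩) (j := ⟨right⟩) ⟨.snd⟩) }
  map_id _ := rfl
  map_comp _ _ := rfl

/-- A modification between cocones on a span, from its values at the two feet. -/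
def homOfSpan {c d : PseudoCocone (functor h g).toPseudofunctor a}
    (f : (toSpanCocone a).obj c ⟶ (toSpanCocone a).obj d) : c ⟶ d :=
  let fl : legLeft c ⟶ legLeft d := f.left
  let fr : legRight c ⟶ legRight d := f.right
  { app := fun x => match x with
      | ⟨zero⟩ => (triFst c).inv ≫ h ◁ fl ≫ (triFst d).hom
      | ⟨left⟩ => fl
      | ⟨right⟩ => fr
    naturality := fun {x y} p => by
      obtain ⟨x⟩ := x
      obtain ⟨y⟩ := y
      obtain ⟨p⟩ := p
      change SpanShape.Hom x y at p
      cases p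
      · exact PseudoCocone.naturality_id _ _
      · change h ◁ fl ≫ (triFst d).hom = (triFst c).hom ≫ (triFst c).inv ≫ h ◁ fl ≫ (triFst d).hom
        exact (Iso.hom_inv_id_assoc _ _).symm
      · change g ◁ fr ≫ (triSnd d).hom = (triSnd c).hom ≫ (triFst c).inv ≫ h ◁ fl ≫ (triFst d).hom
        exact eq_of_comp_inv_eq f.w }

/-- The components of the cocone on a span given by a square. -/
def coconeLeg (s : SpanCocone h g a) : ∀ x : SpanShape.{v}, obj A B X x ⟶ a
  | zero => h ≫ s.inl
  | left => s.inl
  | right => s.inr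

/-- The 2-cells of the cocone on a span given by a square. -/
def coconeTri (s : SpanCocone h g a) : ∀ {x y : SpanShape.{v}} (p : Hom x y),
    map h g p ≫ coconeLeg s y ≅ coconeLeg s x
  | _, _, .id x => λ_ (coconeLeg s x)
  | _, _, .fst => Iso.refl _
  | _, _, .snd => s.iso.symm

/-- The cocone on a span given by a square. -/
def ofSpanCocone (s : SpanCocone h g a) : PseudoCocone (functor h g).toPseudofunctor a where
  ι x := coconeLeg s x.as
  comm p := coconeTri s p.as
  comm_naturality {x y p q} η := by
    obtain rfl := LocallyDiscrete.eq_of_hom η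
    exact (congrArg (· ≫ _) (id_whiskerRight _ _)).trans (Category.id_comp _)
  comm_id x := ((congrArg (· ≫ _) (id_whiskerRight _ _)).trans (Category.id_comp _)).symm
  comm_comp {x y z} p q := by
    obtain ⟨x⟩ := x
    obtain ⟨y⟩ := y
    obtain ⟨z⟩ := z
    obtain ⟨p⟩ := p
    obtain ⟨q⟩ := q
    change (coconeTri s (p.comp q)).hom = eqToHom (map_comp h g p q) ▷ coconeLeg s z ≫
      (α_ (map h g p) (map h g q) (coconeLeg s z)).hom ≫ map h g p ◁ (coconeTri s q).hom ≫
        (coconeTri s p).hom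
    change SpanShape.Hom x y at p
    change SpanShape.Hom y z at q
    cases p
    · have e : eqToHom (map_comp h g (Hom.id x) q) = (λ_ (map h g q)).inv := by
        rw [Strict.leftUnitor_eqToIso]; rfl
      rw [e]
      change _ = _ ≫ _ ≫ 𝟙 _ ◁ _ ≫ (λ_ _).hom
      simp [Hom.comp, map]
    · cases q
      have e : eqToHom (map_comp h g Hom.fst (Hom.id left)) = (ρ_ h).inv := by
        rw [Strict.rightUnitor_eqToIso]; rfl
      rw [e]
      change (coconeTri s Hom.fst).hom = _ ≫ (α_ h (𝟙 _) _).hom ≫ h ◁ (λ_ _).hom ≫ _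
      exact left_triangle_inv h _
    · cases q
      have e : eqToHom (map_comp h g Hom.snd (Hom.id right)) = (ρ_ g).inv := by
        rw [Strict.rightUnitor_eqToIso]; rfl
      rw [e]
      change (coconeTri s Hom.snd).hom = _ ≫ (α_ g (𝟙 _) _).hom ≫ g ◁ (λ_ _).hom ≫ _
      exact left_triangle_inv g _

instance (a : C) : (toSpanCocone (h := h) (g := g) a).IsEquivalence where
  faithful := ⟨fun {c d} f f' e => PseudoCocone.homFunctor_ext fun x => by
    have hl : f.app ⟨left⟩ = f'.app ⟨left⟩ := congrArg SpanCocone.Hom.left e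
    have hr : f.app ⟨right⟩ = f'.app ⟨right⟩ := congrArg SpanCocone.Hom.right e
    obtain ⟨_ | _ | _⟩ := x
    · have h₁ := f.naturality (i := ⟨zero⟩) (j := ⟨left⟩) ⟨.fst⟩
      have h₂ := f'.naturality (i := ⟨zero⟩) (j := ⟨left⟩) ⟨.fst⟩
      rw [hl] at h₁
      exact (cancel_epi _).1 (h₁.symm.trans h₂)
    · exact hl
    · exact hr⟩
  full := ⟨fun f => ⟨homOfSpan f, rfl⟩⟩
  essSurj := ⟨fun s => ⟨ofSpanCocone s, ⟨eqToIso (by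
    obtain ⟨l, r, e⟩ := s
    change SpanCocone.mk l r (Iso.refl _ ≪≫ e) = _
    rw [Iso.refl_trans])⟩⟩⟩

end SpanShape

theorem postcomp_iso_aux {a b : C} {l : X ⟶ a} {k : B ⟶ a} {m : A ⟶ a} (t : h ≫ l ≅ m)
    (t' : g ≫ k ≅ m) (r : a ⟶ b) :
    h ◁ 𝟙 (l ≫ r) ≫ ((α_ h l r).symm ≪≫ whiskerRightIso (t ≪≫ t'.symm) r ≪≫ α_ g k r).hom =
      (((α_ h l r).symm ≪≫ whiskerRightIso t r) ≪≫
        ((α_ g k r).symm ≪≫ whiskerRightIso t' r).symm).hom ≫ g ◁ 𝟙 (k ≫ r) := by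
  simp

/-- A 2-cocomplete strict (2,1)-category has 2-pushouts. -/
theorem exists_isPushout [Bicategory.Strict C] (hC : TwoCocomplete C) :
    ∃ (a : C) (s : SpanCocone h g a), s.IsPushout := by
  obtain ⟨a, c, hc⟩ := hC (LocallyDiscrete SpanShape.{v}) (SpanShape.functor h g)
  refine ⟨a, (SpanShape.toSpanCocone a).obj c, fun b => ?_⟩
  have := hc b
  have e : c.homFunctor b ⋙ SpanShape.toSpanCocone b ≅
      ((SpanShape.toSpanCocone a).obj c).homFunctor b := by
    refine NatIso.ofComponents
      (fun r => SpanCocone.isoMk (Iso.refl _) (Iso.refl _) ?_) fun {r r'} η => ?_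
    · exact postcomp_iso_aux h g (SpanShape.triFst c) (SpanShape.triSnd c) r
    · exact SpanCocone.Hom.ext ((Category.comp_id _).trans (Category.id_comp _).symm)
        ((Category.comp_id _).trans (Category.id_comp _).symm)
  exact Functor.isEquivalence_of_iso e

end Pushouts

end TwoOne

namespace TwoOne

/-! ### Gluing chains, and adding a last object. -/

section Gluing

variable {C : Type u₂} [Bicategory.{w₂, v₂} C]

theorem ChainMaps.ext_of {Y : C} {K : Type u₁} [Preorder K] {o : K → C} {m n : ChainMaps Y o}
    (h₁ : ∀ i j (h : i ≤ j), m.map h = n.map h) (h₂ : ∀ i, m.aug i = n.aug i) : m = n := by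
  obtain ⟨f, p⟩ := m
  obtain ⟨g, q⟩ := n
  obtain rfl : p = q := funext h₂
  obtain rfl : @f = @g := funext fun i => funext fun j => funext fun h => h₁ i j h
  rfl

theorem ChainCells.ext_of {Y : C} {K : Type u₁} [Preorder K] {o : K → C} {m : ChainMaps Y o}
    {s t : ChainCells m} (h₁ : ∀ i, s.mapId i = t.mapId i)
    (h₂ : ∀ {i j k} (h : i ≤ j) (h' : j ≤ k), s.mapComp h h' = t.mapComp h h')
    (h₃ : ∀ {i j} (h : i ≤ j), s.augComp h = t.augComp h) : s = t := by
  obtain ⟨a, b, c, _, _, _, _, _⟩ := s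
  obtain ⟨a', b', c', _, _, _, _, _⟩ := t
  obtain rfl : a = a' := funext h₁
  obtain rfl : @b = @b' := by
    funext i j k h h'
    exact h₂ h h'
  obtain rfl : @c = @c' := by
    funext i j h
    exact h₃ h
  rfl

namespace Chain

variable {Y : C}

section

variable {J : Type u₁} [LinearOrder J]

/-- The inclusion between initial segments. -/
def inclIic {k l : J} (h : k ≤ l) : Set.Iic k →o Set.Iic l :=
  ⟨fun i => ⟨i.1, i.2.trans h⟩, fun _ _ h => h⟩

/-- The inclusion of an initial segment in a lower set. -/
def inclLower {s : Set J} (hs : IsLowerSet s) (l : s) : Set.Iic l.1 →o s :=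
  ⟨fun i => ⟨i.1, hs i.2 l.2⟩, fun _ _ h => h⟩

/-- Compatible diagrams on the closed initial segments of a lower set glue. -/
theorem exists_glue {s : Set J} (hs : IsLowerSet s) (S : ∀ l : s, Chain Y (Set.Iic l.1))
    (compat : ∀ (k l : s) (h : k.1 ≤ l.1), (S l).pull (inclIic h) = S k) :
    ∃ G : Chain Y s, ∀ l : s, G.pull (inclLower hs l) = S l := by
  -- Objects, 1-cells and 2-cells are glued in turn: each layer has a type depending on the previous
  -- one, which must be made literally equal first. The value at `i` is read off from `S i`, where
  -- `i` is the last index.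
  have h₁ : ∃ o : s → C, ∀ l : s, ∃ m t, S l = ⟨fun i => o (inclLower hs l i), m, t⟩ := by
    refine ⟨fun i => (S i).obj ⟨i, le_rfl⟩, fun l => ?_⟩
    have h : (S l).obj = fun i => (S (inclLower hs l i)).obj ⟨i.1, le_rfl⟩ := funext fun i =>
      congrFun (congrArg Chain.obj (compat (inclLower hs l i) l i.2)) ⟨i.1, le_rfl⟩
    revert h
    generalize S l = X
    obtain ⟨o, m, t⟩ := X
    rintro rfl
    exact ⟨m, t, rfl⟩
  obtain ⟨o, h₁⟩ := h₁
  choose m t hS using h₁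
  have hm : ∀ (k l : s) (h : k.1 ≤ l.1), (m l).pull (inclIic h) = m k := fun k l h => by
    have := compat k l h
    rw [hS, hS] at this
    exact eq_of_heq (Chain.mk.inj this).2.1
  have h₂ : ∃ M : ChainMaps Y o, ∀ l : s, ∃ t : ChainCells (M.pull (inclLower hs l)),
      S l = ⟨fun i => o (inclLower hs l i), M.pull (inclLower hs l), t⟩ := by
    refine ⟨⟨fun {i j} h => (m j).map (i := ⟨i.1, h⟩) (j := ⟨j.1, le_rfl⟩) h,
      fun i => (m i).aug ⟨i.1, le_rfl⟩⟩, fun l => ?_⟩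
    have h : m l = ChainMaps.pull (o := o)
        ⟨fun {i j} h => (m j).map (i := ⟨i.1, h⟩) (j := ⟨j.1, le_rfl⟩) h,
          fun i => (m i).aug ⟨i.1, le_rfl⟩⟩ (inclLower hs l) := by
      have e₁ : ∀ (i j : Set.Iic l.1) (h : i ≤ j), (m l).map h =
          (m (inclLower hs l j)).map (i := ⟨i.1, h⟩) (j := ⟨j.1, le_rfl⟩) h := fun i j h =>
        congrArg (fun n => ChainMaps.map n (i := ⟨i.1, h⟩) (j := ⟨j.1, le_rfl⟩) h)
          (hm (inclLower hs l j) l j.2)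
      have e₂ : ∀ i : Set.Iic l.1, (m l).aug i = (m (inclLower hs l i)).aug ⟨i.1, le_rfl⟩ :=
        fun i => congrArg (fun n => ChainMaps.aug n ⟨i.1, le_rfl⟩) (hm (inclLower hs l i) l i.2)
      exact ChainMaps.ext_of e₁ e₂
    have hl := hS l
    revert hl
    generalize t l = t'
    revert t'
    rw [h]
    exact fun t' h' => ⟨t', h'⟩
  obtain ⟨M, h₂⟩ := h₂
  clear! m
  choose t hS using h₂
  have ht : ∀ (k l : s) (h : k.1 ≤ l.1), (t l).pull (inclIic h) = t k := fun k l h => by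
    have := compat k l h
    rw [hS, hS] at this
    exact eq_of_heq (Chain.mk.inj this).2.2
  -- Each 2-cell is read off from the diagram at the largest index involved.
  let mc : ∀ {i j k : s} (h : i ≤ j) (h' : j ≤ k), M.map (h.trans h') ≅ M.map h ≫ M.map h' :=
    fun {i j k} h h' => (t k).mapComp (i := ⟨i.1, h.trans h'⟩) (j := ⟨j.1, h'⟩)
      (k := ⟨k.1, le_rfl⟩) h h'
  let ac : ∀ {i j : s} (h : i ≤ j), M.map h ≫ M.aug j ≅ M.aug i :=
    fun {i j} h => (t j).augComp (i := ⟨i.1, h⟩) (j := ⟨j.1, le_rfl⟩) h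
  let mi : ∀ i : s, M.map (le_refl i) ≅ 𝟙 (o i) := fun i => (t i).mapId ⟨i.1, le_rfl⟩
  have e₁ : ∀ (l : s) (i j k : Set.Iic l.1) (h : i ≤ j) (h' : j ≤ k), (t l).mapComp h h' =
      mc (i := inclLower hs l i) (j := inclLower hs l j) (k := inclLower hs l k) h h' :=
    fun l i j k h h' => congrArg (fun n => ChainCells.mapComp n (i := ⟨i.1, h.trans h'⟩)
      (j := ⟨j.1, h'⟩) (k := ⟨k.1, le_rfl⟩) h h') (ht (inclLower hs l k) l k.2)
  have e₂ : ∀ (l : s) (i j : Set.Iic l.1) (h : i ≤ j), (t l).augComp h =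
      ac (i := inclLower hs l i) (j := inclLower hs l j) h :=
    fun l i j h => congrArg (fun n => ChainCells.augComp n (i := ⟨i.1, h⟩)
      (j := ⟨j.1, le_rfl⟩) h) (ht (inclLower hs l j) l j.2)
  have e₃ : ∀ (l : s) (i : Set.Iic l.1), (t l).mapId i = mi (inclLower hs l i) :=
    fun l i => congrArg (fun n => ChainCells.mapId n ⟨i.1, le_rfl⟩) (ht (inclLower hs l i) l i.2)
  refine ⟨⟨o, M,
    { mapId := mi
      mapComp := mc
      augComp := ac
      assoc := fun {i j k l} h h' h'' => ?_
      left_unit := fun {i j} h => ?_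
      right_unit := fun {i j} h => ?_
      aug_id := fun i => ?_
      aug_comp := fun {i j k} h h' => ?_ }⟩, fun l => ?_⟩
  · have := (t l).assoc (i := ⟨i.1, (h.trans h').trans h''⟩) (j := ⟨j.1, h'.trans h''⟩)
      (k := ⟨k.1, h''⟩) (l := ⟨l.1, le_rfl⟩) h h' h''
    rw [e₁, e₁, e₁, e₁] at this
    exact this
  · have := (t j).left_unit (i := ⟨i.1, h⟩) (j := ⟨j.1, le_rfl⟩) h
    rw [e₁, e₃] at this
    exact this
  · have := (t j).right_unit (i := ⟨i.1, h⟩) (j := ⟨j.1, le_rfl⟩) h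
    rw [e₁, e₃] at this
    exact this
  · exact (t i).aug_id ⟨i.1, le_rfl⟩
  · have := (t k).aug_comp (i := ⟨i.1, h.trans h'⟩) (j := ⟨j.1, h'⟩) (k := ⟨k.1, le_rfl⟩) h h'
    rw [e₁, e₂, e₂, e₂] at this
    exact this
  · rw [hS]
    exact congrArg (Chain.mk _ _) (ChainCells.ext_of (fun i => (e₃ l i).symm)
      (fun h h' => (e₁ l _ _ _ h h').symm) fun h => (e₂ l _ _ h).symm)

end

section Snoc

variable {K : Type u₁} [Preorder K] (G : Chain Y K) {Z : C} (c : PseudoCocone G.toPseudo Z)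
  (r : Z ⟶ Y) (p : (c.homFunctor Y).obj r ≅ G.augCocone)

/-- The comparison 2-cells of a factorization of the augmentation through a cocone. -/
def augIso (i : K) : leg c i ≫ r ≅ G.aug i := PseudoCocone.isoApp p ⟨i⟩

theorem augIso_naturality {i j : K} (h : i ≤ j) :
    G.map h ◁ (augIso G c r p j).hom ≫ (G.augComp h).hom =
      ((α_ _ _ _).inv ≫ (tri c h).hom ▷ r) ≫ (augIso G c r p i).hom :=
  PseudoCocone.isoApp_naturality p (homOfLE h).toLoc

/-- The objects of a diagram extended by a last one. -/
def snocObj (Z : C) : WithTop K → C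
  | (i : K) => G.obj i
  | ⊤ => Z

/-- The transition maps of a diagram extended by a last object. -/
def snocMap : ∀ {i j : WithTop K}, i ≤ j → (G.snocObj Z i ⟶ G.snocObj Z j)
  | (_ : K), (_ : K), h => G.map (WithTop.coe_le_coe.1 h)
  | (i : K), ⊤, _ => leg c i
  | ⊤, ⊤, _ => 𝟙 Z
  | ⊤, (j : K), h => absurd h (WithTop.not_top_le_coe j)

/-- The augmentation of a diagram extended by a last object. -/
def snocAug : ∀ i : WithTop K, G.snocObj Z i ⟶ Y
  | (i : K) => G.aug i
  | ⊤ => r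

/-- The 1-cells of a diagram extended by a last object. -/
def snocMaps : ChainMaps Y (G.snocObj Z) where
  map := G.snocMap c
  aug := G.snocAug r

/-- The identity constraints of a diagram extended by a last object. -/
def snocMapId : ∀ i : WithTop K, G.snocMap c (le_refl i) ≅ 𝟙 (G.snocObj Z i)
  | (i : K) => G.mapId i
  | ⊤ => Iso.refl _

/-- The composition constraints of a diagram extended by a last object. -/
def snocMapComp : ∀ {i j k : WithTop K} (h : i ≤ j) (h' : j ≤ k),
    G.snocMap c (h.trans h') ≅ G.snocMap c h ≫ G.snocMap c h'
  | (_ : K), (_ : K), (_ : K), h, h' => G.mapComp (WithTop.coe_le_coe.1 h) (WithTop.coe_le_coe.1 h')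
  | (_ : K), (_ : K), ⊤, h, _ => (tri c (WithTop.coe_le_coe.1 h)).symm
  | (i : K), ⊤, ⊤, _, _ => (ρ_ (leg c i)).symm
  | ⊤, ⊤, ⊤, _, _ => (λ_ (𝟙 Z)).symm
  | ⊤, (j : K), _, h, _ => absurd h (WithTop.not_top_le_coe j)
  | _, ⊤, (j : K), _, h => absurd h (WithTop.not_top_le_coe j)

/-- The augmentation constraints of a diagram extended by a last object. -/
def snocAugComp : ∀ {i j : WithTop K} (h : i ≤ j),
    G.snocMap c h ≫ G.snocAug r j ≅ G.snocAug r i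
  | (_ : K), (_ : K), h => G.augComp (WithTop.coe_le_coe.1 h)
  | (i : K), ⊤, _ => augIso G c r p i
  | ⊤, ⊤, _ => λ_ r
  | ⊤, (j : K), h => absurd h (WithTop.not_top_le_coe j)

theorem tri_inv_assoc {i j k : K} (h : i ≤ j) (h' : j ≤ k) :
    (tri c (h.trans h')).inv ≫ (G.mapComp h h').hom ▷ leg c k ≫ (α_ _ _ _).hom =
      (tri c h).inv ≫ G.map h ◁ (tri c h').inv := by
  rw [Iso.inv_comp_eq, tri_comp c h h']
  simp

theorem tri_inv_left_unit (i : K) :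
    (tri c (le_refl i)).inv ≫ (G.mapId i).hom ▷ leg c i ≫ (λ_ _).hom = 𝟙 _ := by
  rw [Iso.inv_comp_eq, tri_id, Category.comp_id]

theorem augIso_comp {i j : K} (h : i ≤ j) :
    (augIso G c r p i).hom = (tri c h).inv ▷ r ≫ (α_ _ _ _).hom ≫
      G.map h ◁ (augIso G c r p j).hom ≫ (G.augComp h).hom := by
  rw [augIso_naturality]
  simp

theorem rightUnitor_inv_whisker_assoc {x y z : C} {l : x ⟶ z} {m : x ⟶ y} {l' : y ⟶ z}
    (φ : l ⟶ m ≫ l') :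
    (ρ_ l).inv ≫ φ ▷ 𝟙 z ≫ (α_ m l' (𝟙 z)).hom = φ ≫ m ◁ (ρ_ l').inv := by
  simp

theorem rightUnitor_inv_twice {x z : C} (l : x ⟶ z) :
    (ρ_ l).inv ≫ (ρ_ l).inv ▷ 𝟙 z ≫ (α_ l (𝟙 z) (𝟙 z)).hom = (ρ_ l).inv ≫ l ◁ (λ_ (𝟙 z)).inv := by
  simp

theorem leftUnitor_inv_twice (z : C) :
    (λ_ (𝟙 z)).inv ≫ (λ_ (𝟙 z)).inv ▷ 𝟙 z ≫ (α_ (𝟙 z) (𝟙 z) (𝟙 z)).hom =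
      (λ_ (𝟙 z)).inv ≫ 𝟙 z ◁ (λ_ (𝟙 z)).inv := by
  simp

theorem snoc_assoc : ∀ {i j k l : WithTop K} (h : i ≤ j) (h' : j ≤ k) (h'' : k ≤ l),
    (G.snocMapComp c (h.trans h') h'').hom ≫
        (G.snocMapComp c h h').hom ▷ G.snocMap c h'' ≫ (α_ _ _ _).hom =
      (G.snocMapComp c h (h'.trans h'')).hom ≫ G.snocMap c h ◁ (G.snocMapComp c h' h'').hom
  | (_ : K), (_ : K), (_ : K), (_ : K), h, h', h'' => G.cells.assoc (WithTop.coe_le_coe.1 h)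
      (WithTop.coe_le_coe.1 h') (WithTop.coe_le_coe.1 h'')
  | (_ : K), (_ : K), (_ : K), ⊤, h, h', _ =>
      tri_inv_assoc G c (WithTop.coe_le_coe.1 h) (WithTop.coe_le_coe.1 h')
  | (_ : K), (_ : K), ⊤, ⊤, h, _, _ =>
      rightUnitor_inv_whisker_assoc (tri c (WithTop.coe_le_coe.1 h)).inv
  | (i : K), ⊤, ⊤, ⊤, _, _, _ => rightUnitor_inv_twice (leg c i)
  | ⊤, ⊤, ⊤, ⊤, _, _, _ => leftUnitor_inv_twice Z
  | ⊤, (j : K), _, _, h, _, _ => absurd h (WithTop.not_top_le_coe j)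
  | _, ⊤, (j : K), _, _, h, _ => absurd h (WithTop.not_top_le_coe j)
  | _, _, ⊤, (j : K), _, _, h => absurd h (WithTop.not_top_le_coe j)

theorem snoc_left_unit : ∀ {i j : WithTop K} (h : i ≤ j),
    (G.snocMapComp c (le_refl i) h).hom ≫ (G.snocMapId c i).hom ▷ G.snocMap c h ≫ (λ_ _).hom = 𝟙 _
  | (_ : K), (_ : K), h => G.cells.left_unit (WithTop.coe_le_coe.1 h)
  | (i : K), ⊤, _ => tri_inv_left_unit G c i
  | ⊤, ⊤, _ => by
      change (λ_ (𝟙 Z)).inv ≫ 𝟙 _ ▷ _ ≫ (λ_ (𝟙 Z)).hom = 𝟙 _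
      simp
  | ⊤, (j : K), h => absurd h (WithTop.not_top_le_coe j)

theorem snoc_right_unit : ∀ {i j : WithTop K} (h : i ≤ j),
    (G.snocMapComp c h (le_refl j)).hom ≫ G.snocMap c h ◁ (G.snocMapId c j).hom ≫ (ρ_ _).hom = 𝟙 _
  | (_ : K), (_ : K), h => G.cells.right_unit (WithTop.coe_le_coe.1 h)
  | (i : K), ⊤, _ => by
      change (ρ_ (leg c i)).inv ≫ _ ◁ 𝟙 _ ≫ (ρ_ (leg c i)).hom = 𝟙 _
      simp
  | ⊤, ⊤, _ => by
      change (λ_ (𝟙 Z)).inv ≫ _ ◁ 𝟙 _ ≫ (ρ_ (𝟙 Z)).hom = 𝟙 _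
      simp
  | ⊤, (j : K), h => absurd h (WithTop.not_top_le_coe j)

theorem snoc_aug_id : ∀ i : WithTop K, (G.snocAugComp c r p (le_refl i)).hom =
    (G.snocMapId c i).hom ▷ G.snocAug r i ≫ (λ_ _).hom
  | (i : K) => G.cells.aug_id i
  | ⊤ => by
      change (λ_ r).hom = 𝟙 _ ▷ r ≫ (λ_ r).hom
      simp

theorem snoc_aug_comp : ∀ {i j k : WithTop K} (h : i ≤ j) (h' : j ≤ k),
    (G.snocAugComp c r p (h.trans h')).hom = (G.snocMapComp c h h').hom ▷ G.snocAug r k ≫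
      (α_ _ _ _).hom ≫ G.snocMap c h ◁ (G.snocAugComp c r p h').hom ≫ (G.snocAugComp c r p h).hom
  | (_ : K), (_ : K), (_ : K), h, h' =>
      G.cells.aug_comp (WithTop.coe_le_coe.1 h) (WithTop.coe_le_coe.1 h')
  | (_ : K), (_ : K), ⊤, h, _ => augIso_comp G c r p (WithTop.coe_le_coe.1 h)
  | (i : K), ⊤, ⊤, _, _ => left_triangle_inv (leg c i) (augIso G c r p i).hom
  | ⊤, ⊤, ⊤, _, _ => by
      change (λ_ r).hom = (λ_ (𝟙 Z)).inv ▷ r ≫ (α_ _ _ _).hom ≫ _ ◁ (λ_ r).hom ≫ (λ_ r).hom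
      simp
  | ⊤, (j : K), _, h, _ => absurd h (WithTop.not_top_le_coe j)
  | _, ⊤, (j : K), _, h => absurd h (WithTop.not_top_le_coe j)

/-- The 2-cells of a diagram extended by a last object. -/
def snocCells : ChainCells (G.snocMaps c r) where
  mapId := G.snocMapId c
  mapComp := G.snocMapComp c
  augComp := G.snocAugComp c r p
  assoc := G.snoc_assoc c
  left_unit := G.snoc_left_unit c
  right_unit := G.snoc_right_unit c
  aug_id := G.snoc_aug_id c r p
  aug_comp := G.snoc_aug_comp c r p

/-- The extension of a diagram by a last object, given by a cocone through which the augmentation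
factors. -/
def snoc : Chain Y (WithTop K) where
  obj := G.snocObj Z
  maps := G.snocMaps c r
  cells := G.snocCells c r p

/-- The inclusion of a preorder in its extension by a largest element. -/
def inclWithTop (K : Type u₁) [Preorder K] : K →o WithTop K :=
  ⟨WithTop.some, WithTop.coe_mono⟩

end Snoc

end Chain

end Gluing

end TwoOne

namespace TwoOne

/-! ### Lifting problems and good stages. -/

section Lifting

variable {C : Type u} [Bicategory.{v, v} C] {Y : C}

/-- The square `η` from `g` to `p` has a diagonal filler. -/
def HasLift {x a b : C} (p : x ⟶ Y) (g : a ⟶ b) (h : a ⟶ x) (h' : b ⟶ Y)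
    (η : g ≫ h' ⟶ h ≫ p) : Prop :=
  ∃ (k : b ⟶ x) (ν₁ : g ≫ k ⟶ h) (ν₂ : h' ⟶ k ≫ p),
    g ◁ ν₂ ≫ (α_ g k p).inv ≫ ν₁ ▷ p = η

theorem HasLift.postcomp_cell {x a b : C} {p : x ⟶ Y} {g : a ⟶ b} {h h₁ : a ⟶ x} {h' : b ⟶ Y}
    {η : g ≫ h' ⟶ h ≫ p} (hη : HasLift p g h h' η) (β : h ⟶ h₁) :
    HasLift p g h₁ h' (η ≫ β ▷ p) := by
  obtain ⟨k, ν₁, ν₂, rfl⟩ := hη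
  exact ⟨k, ν₁ ≫ β, ν₂, by simp⟩

theorem HasLift.postcomp {x x' a b : C} {p : x ⟶ Y} {g : a ⟶ b} {h : a ⟶ x} {h' : b ⟶ Y}
    {η : g ≫ h' ⟶ h ≫ p} (hη : HasLift p g h h' η) {m : x ⟶ x'} {p' : x' ⟶ Y}
    (t : m ≫ p' ≅ p) :
    HasLift p' g (h ≫ m) h' (η ≫ h ◁ t.inv ≫ (α_ h m p').inv) := by
  obtain ⟨k, ν₁, ν₂, rfl⟩ := hη
  refine ⟨k ≫ m, (α_ g k m).inv ≫ ν₁ ▷ m, ν₂ ≫ k ◁ t.inv ≫ (α_ k m p').inv, ?_⟩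
  simp only [whiskerLeft_comp, comp_whiskerRight, Category.assoc]
  rw [← whisker_exchange_assoc]
  simp

/-- The lifting problems of `p` against the 1-cells in `I`. -/
structure Problem (I : Set (Arr C)) {x : C} (p : x ⟶ Y) where
  gen : I
  top : gen.1.left ⟶ x
  bot : gen.1.right ⟶ Y
  cell : gen.1.hom ≫ bot ⟶ top ≫ p

/-- Local smallness of `C` enters here: apart from the generator, a problem consists of 1-cells and
a 2-cell. This bound drives the counting in `exists_solved`. -/
instance (I : Set (Arr C)) [Small.{v} I] {x : C} (p : x ⟶ Y) : Small.{v} (Problem I p) :=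
  small_of_injective
    (β := Σ (g : I) (h : g.1.left ⟶ x) (h' : g.1.right ⟶ Y), g.1.hom ≫ h' ⟶ h ≫ p)
    (f := fun q => ⟨q.gen, q.top, q.bot, q.cell⟩) fun q q' h => by
      obtain ⟨g, t, b, c⟩ := q
      obtain ⟨g', t', b', c'⟩ := q'
      obtain ⟨rfl, h⟩ := Sigma.mk.inj h
      obtain ⟨rfl, h⟩ := Sigma.mk.inj (eq_of_heq h)
      obtain ⟨rfl, h⟩ := Sigma.mk.inj (eq_of_heq h)
      obtain rfl := eq_of_heq h
      rfl

theorem mem_inj_iff (I : Set (Arr C)) {x : C} (p : x ⟶ Y) :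
    Arr.mk p ∈ inj I ↔ ∀ q : Problem I p, HasLift p q.gen.1.hom q.top q.bot q.cell :=
  ⟨fun H q => H q.gen.1 q.gen.2 q.top q.bot q.cell, fun H g hg h h' η => H ⟨⟨g, hg⟩, h, h', η⟩⟩

variable {I : Set (Arr C)} {K : Type u₁} [LinearOrder K]

namespace Chain

/-- The lifting problem `q` at the stage `i` has a solution at the stage `j`. -/
def Solved (G : Chain Y K) {i j : K} (h : i ≤ j) (q : Problem I (G.aug i)) : Prop :=
  HasLift (G.aug j) q.gen.1.hom (q.top ≫ G.map h) q.bot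
    (q.cell ≫ q.top ◁ (G.augComp h).inv ≫ (α_ _ _ _).inv)

variable {G : Chain Y K}

/-- The filler is followed by the transition map; `aug_comp` and the composition constraint match
the resulting square with the original problem. -/
theorem Solved.mono {i j k : K} {h : i ≤ j} {q : Problem I (G.aug i)} (hq : G.Solved h q)
    (h' : j ≤ k) : G.Solved (h.trans h') q := by
  have := (HasLift.postcomp hq (G.augComp h')).postcomp_cell
    ((α_ _ _ _).hom ≫ q.top ◁ (G.mapComp h h').inv)
  have e : (G.augComp (h.trans h')).inv = (G.augComp h).inv ≫ G.map h ◁ (G.augComp h').inv ≫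
      (α_ _ _ _).inv ≫ (G.mapComp h h').inv ▷ G.aug k := by
    have e : G.augComp (h.trans h') = whiskerRightIso (G.mapComp h h') _ ≪≫ α_ _ _ _ ≪≫
        whiskerLeftIso _ (G.augComp h') ≪≫ G.augComp h := Iso.ext (G.cells.aug_comp h h')
    rw [e]
    simp
  unfold Solved
  rw [e]
  convert this using 1
  simp

theorem solved_refl {i : K} {q : Problem I (G.aug i)} (hq : G.Solved le_rfl q) :
    HasLift (G.aug i) q.gen.1.hom q.top q.bot q.cell := by
  have := HasLift.postcomp_cell hq (q.top ◁ (G.mapId i).hom ≫ (ρ_ _).hom)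
  convert this using 1
  have e : G.augComp (le_refl i) = whiskerRightIso (G.mapId i) _ ≪≫ λ_ _ :=
    Iso.ext (G.cells.aug_id i)
  rw [e]
  simp

theorem exists_not_solved {i : K} (hi : Arr.mk (G.aug i) ∉ inj I) :
    ∃ q : Problem I (G.aug i), ¬ G.Solved le_rfl q := by
  rw [mem_inj_iff] at hi
  push Not at hi
  exact hi.imp fun q hq hq' => hq (solved_refl hq')

/-- A problem at the stage `j` that comes, up to isomorphism, from a problem that has a solution at
the stage `j`, has a solution. -/
theorem exists_problem {i j k : K} (h : i ≤ k) (h' : j ≤ k) (q : Problem I (G.aug i))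
    (t : q.gen.1.left ⟶ G.obj j) (β : t ≫ G.map h' ≅ q.top ≫ G.map h) :
    ∃ q' : Problem I (G.aug j), G.Solved h' q' → G.Solved h q := by
  -- The 2-cell of the new problem transports `q` up to the stage `k`, crosses `β` backwards, and
  -- comes down to the stage `j`.
  refine ⟨⟨q.gen, t, q.bot, q.cell ≫ q.top ◁ (G.augComp h).inv ≫ (α_ _ _ _).inv ≫
    β.inv ▷ G.aug k ≫ (α_ _ _ _).hom ≫ t ◁ (G.augComp h').hom⟩, fun hq => ?_⟩
  have := HasLift.postcomp_cell hq β.hom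
  unfold Solved
  convert this using 1
  simp

/-- The step from `i` to `j` attaches a cell along a lifting problem without a solution at the stage
`i` that comes from a stage that is as early as possible. -/
def IsStep (I : Set (Arr C)) (G : Chain Y K) {i j : K} (h : i ≤ j) : Prop :=
  Arr.mk (G.map h) ∈ pushouts I ∧ ∃ (a : K) (ha : a ≤ i) (q : Problem I (G.aug a)),
    ¬ G.Solved ha q ∧ G.Solved (ha.trans h) q ∧
      ∀ (b : K) (hb : b < a) (q' : Problem I (G.aug b)), G.Solved (hb.le.trans ha) q'

/-- The stage `j` of the diagram is built as in the small object argument applied to `f`. -/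
structure Good (I : Set (Arr C)) {X : C} (f : X ⟶ Y) (G : Chain Y K) (j : K) : Prop where
  zero : IsMin j → Arr.mk (G.aug j) = Arr.mk f
  succ {i : K} (h : i ⋖ j) : G.IsStep I h.le
  limit : Order.IsSuccLimit j → (G.coconeBelow j).IsColimit

end Chain

/-- The monotone map `e` is the inclusion of an initial segment. -/
structure IsInitial {K' : Type u₂} [LinearOrder K'] (e : K' →o K) : Prop where
  le_iff {a b : K'} : e a ≤ e b ↔ a ≤ b
  mem_range {a : K'} {b : K} : b ≤ e a → ∃ c, e c = b

namespace Chain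

variable {K' : Type u₂} [LinearOrder K'] {e : K' →o K} {G : Chain Y K}

/-- The initial segment given by an initial inclusion. -/
def _root_.TwoOne.IsInitial.seg (he : IsInitial e) : K' ≤i K where
  toFun := e
  inj' a b h := le_antisymm (he.le_iff.1 h.le) (he.le_iff.1 h.ge)
  map_rel_iff' {a b} := by
    change e a < e b ↔ a < b
    rw [← not_le, he.le_iff, not_le]
  mem_range_of_rel' a b h := he.mem_range h.le

/-- The indices below an index of an initial segment. -/
noncomputable def _root_.TwoOne.IsInitial.iio (he : IsInitial e) (k : K') :
    Set.Iio k ≃o Set.Iio (e k) where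
  toEquiv := Equiv.ofBijective (fun i => ⟨e i, he.seg.strictMono i.2⟩)
    ⟨fun i j h => Subtype.ext (he.seg.injective (congrArg Subtype.val h)), fun ⟨j, hj⟩ => by
      obtain ⟨i, rfl⟩ := he.mem_range (le_of_lt hj)
      exact ⟨⟨i, he.seg.lt_iff_lt.1 hj⟩, rfl⟩⟩
  map_rel_iff' := he.le_iff

/-- The earliest-first clause ranges over every index below `a`; all of these lie in the image
because `e` is an initial inclusion. -/
theorem isStep_pull_iff (he : IsInitial e) {i j : K'} (h : i ≤ j) :
    (G.pull e).IsStep I h ↔ G.IsStep I (e.monotone h) := by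
  refine and_congr Iff.rfl ⟨?_, ?_⟩
  · rintro ⟨a, ha, q, h₁, h₂, h₃⟩
    refine ⟨e a, e.monotone ha, q, h₁, h₂, fun b hb => ?_⟩
    obtain ⟨b, rfl⟩ := he.mem_range hb.le
    exact h₃ b (he.seg.lt_iff_lt.1 hb)
  · rintro ⟨a, ha, q, h₁, h₂, h₃⟩
    obtain ⟨a, rfl⟩ := he.mem_range ha
    exact ⟨a, he.le_iff.1 ha, q, h₁, h₂, fun b hb => h₃ (e b) (he.seg.strictMono hb)⟩

theorem good_pull_iff {X : C} {f : X ⟶ Y} (he : IsInitial e) (j : K') :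
    (G.pull e).Good I f j ↔ G.Good I f (e j) := by
  have h₁ : IsMin (e j) ↔ IsMin j := he.seg.isMin_apply_iff
  have h₂ : Order.IsSuccLimit (e j) ↔ Order.IsSuccLimit j := he.seg.isSuccLimit_apply_iff
  have h₃ : ((G.pull e).coconeBelow j).IsColimit ↔ (G.coconeBelow (e j)).IsColimit :=
    isColimit_pullCocone_iff (G.coconeBelow (e j)) (he.iio j)
  constructor
  · intro H
    refine ⟨fun h => H.zero (h₁.1 h), fun {i} h => ?_, fun h => h₃.1 (H.limit (h₂.1 h))⟩
    obtain ⟨i, rfl⟩ := he.mem_range h.le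
    exact (isStep_pull_iff he _).1 (H.succ (he.seg.apply_covBy_apply_iff.1 h))
  · intro H
    exact ⟨fun h => H.zero (h₁.2 h), fun {i} h => (isStep_pull_iff he h.le).2
      (H.succ (he.seg.apply_covBy_apply_iff.2 h)), fun h => h₃.2 (H.limit (h₂.2 h))⟩

end Chain

end Lifting

end TwoOne

namespace TwoOne

/-! ### Extending a chain by one stage. -/

section Extension

theorem SpanCocone.IsPushout.of_iso {C : Type u₂} [Bicategory.{w₂, v₂} C] {A B X a : C} {h : A ⟶ X}
    {g : A ⟶ B} {s t : SpanCocone h g a} (hs : s.IsPushout) (l : s.inl ≅ t.inl)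
    (r : s.inr ≅ t.inr) (w : h ◁ l.hom ≫ t.iso.hom = s.iso.hom ≫ g ◁ r.hom) : t.IsPushout := by
  intro b
  have := hs b
  refine Functor.isEquivalence_of_iso (F := s.homFunctor b) (NatIso.ofComponents
    (fun m => SpanCocone.isoMk (whiskerRightIso l m) (whiskerRightIso r m) ?_) fun {m m'} η => ?_)
  · change h ◁ l.hom ▷ m ≫ (α_ _ _ _).inv ≫ t.iso.hom ▷ m ≫ (α_ _ _ _).hom =
      ((α_ _ _ _).inv ≫ s.iso.hom ▷ m ≫ (α_ _ _ _).hom) ≫ g ◁ r.hom ▷ m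
    have := congrArg (· ▷ m) w
    simp only [comp_whiskerRight, whisker_assoc, Category.assoc] at this
    rw [← cancel_epi (α_ h s.inl m).hom, ← cancel_mono (α_ g t.inr m).inv]
    simpa using this
  · exact SpanCocone.Hom.ext (whisker_exchange _ _) (whisker_exchange _ _)

variable {C : Type u} [Bicategory.{v, v} C] {X Y : C}

namespace Chain

section

variable {K : Type u₁} [Preorder K] {G : Chain Y K}

/-- A factorization of the augmentation through a cocone, composed with a triangle. -/
def compAugIso {x P : C} (d : PseudoCocone G.toPseudo x) {p : x ⟶ Y} {n : x ⟶ P} {r : P ⟶ Y}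
    (e : (d.homFunctor Y).obj p ≅ G.augCocone) (t : n ≫ r ≅ p) :
    ((d.postcomp n).homFunctor Y).obj r ≅ G.augCocone :=
  (show ((d.postcomp n).homFunctor Y).obj r ≅ (d.homFunctor Y).obj (n ≫ r) from
    PseudoCocone.isoMk (fun i => α_ (d.ι i) n r) fun {i j} f => by
    change G.toPseudo.map f ◁ (α_ (d.ι j) n r).hom ≫ (α_ _ _ _).inv ≫ (d.comm f).hom ▷ (n ≫ r) =
      ((α_ _ _ _).inv ≫ ((α_ _ _ _).inv ≫ (d.comm f).hom ▷ n) ▷ r) ≫ (α_ (d.ι i) n r).hom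
    simp) ≪≫ (d.homFunctor Y).mapIso t ≪≫ e

/-- The augmentation factors through the value at a largest index. -/
def topAugIso (G : Chain Y K) (t : K) (ht : ∀ i, i ≤ t) :
    ((G.coconeTop t ht).homFunctor Y).obj (G.aug t) ≅ G.augCocone :=
  mkIso (fun i => G.augComp (ht i)) fun {i j} h => by
    change G.map h ◁ (G.augComp (ht j)).hom ≫ (G.augComp h).hom =
      ((α_ _ _ _).inv ≫ (G.mapComp h (ht j)).inv ▷ G.aug t) ≫ (G.augComp (ht i)).hom
    rw [G.cells.aug_comp h (ht j)]
    simp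

end

variable {I : Set (Arr C)} {f : X ⟶ Y} {K : Type u₁} [LinearOrder K]

theorem exists_extension_of_isEmpty [IsEmpty K] (G : Chain Y K) :
    ∃ E : Chain Y (WithTop K), E.pull (inclWithTop K) = G ∧ E.Good I f ⊤ := by
  let c : PseudoCocone G.toPseudo X := G.mkCocone (fun i => isEmptyElim i)
    (fun {i} => isEmptyElim i) (fun i => isEmptyElim i) (fun {i} => isEmptyElim i)
  let p : (c.homFunctor Y).obj f ≅ G.augCocone := mkIso (fun i => isEmptyElim i)
    (fun {i} => isEmptyElim i)
  have hmin : IsMin (⊤ : WithTop K) := fun b _ => by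
    induction b with
    | top => exact le_rfl
    | coe k => exact isEmptyElim k
  exact ⟨G.snoc c f p, rfl, fun _ => rfl, fun h => absurd h.lt (hmin.not_lt),
    fun h => absurd hmin h.1⟩

theorem exists_extension_of_noMax [NoMaxOrder K] [Nonempty K] (G : Chain Y K)
    {a : C} (c : PseudoCocone G.toPseudo a) (hc : c.IsColimit) :
    ∃ E : Chain Y (WithTop K), E.pull (inclWithTop K) = G ∧ E.Good I f ⊤ := by
  have := hc Y
  -- Essential surjectivity of the comparison functor supplies the map from the colimit to `Y`, with
  -- the coherent 2-cells that `snoc` needs.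
  obtain ⟨r, ⟨p⟩⟩ := Functor.EssSurj.mem_essImage (F := c.homFunctor Y) G.augCocone
  refine ⟨G.snoc c r p, rfl, fun h => ?_, fun {i} h => ?_, fun _ => ?_⟩
  · exact absurd (WithTop.coe_lt_top (Classical.arbitrary K)) h.not_lt
  · induction i with
    | top => exact absurd h.lt (lt_irrefl _)
    | coe i =>
      obtain ⟨j, hj⟩ := exists_gt i
      exact absurd (WithTop.coe_lt_top j) (h.2 (WithTop.coe_lt_coe.2 hj))
  · let e : K ≃o Set.Iio (⊤ : WithTop K) :=
      { toEquiv := Equiv.ofBijective (fun k => ⟨(k : WithTop K), WithTop.coe_lt_top k⟩)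
          ⟨fun i j h => WithTop.coe_injective (congrArg Subtype.val h), fun ⟨k, hk⟩ => by
            induction k with
            | top => exact absurd (Set.mem_Iio.1 hk) (lt_irrefl _)
            | coe k => exact ⟨k, rfl⟩⟩
        map_rel_iff' := WithTop.coe_le_coe }
    exact (isColimit_pullCocone_iff ((G.snoc c r p).coconeBelow ⊤) e).1 hc

/-- The filler is the coprojection `inr` of the attached cell; its 2-cells are the inverses of the
square and of the comparison `k`. The equation is the inverse of `w`, the compatibility of the two
comparisons over `Y`. -/
theorem solved_snoc_aux {a b x z P : C} {g : a ⟶ b} {top : a ⟶ x} {bot : b ⟶ Y} {px : x ⟶ Y}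
    {pz : z ⟶ Y} {m : x ⟶ z} {η : g ≫ bot ⟶ top ≫ px} (t : m ≫ pz ≅ px) {inl : z ⟶ P}
    {inr : b ⟶ P} {r : P ⟶ Y} (s : (top ≫ m) ≫ inl ≅ g ≫ inr) (l : inl ≫ r ≅ pz)
    (k : inr ≫ r ≅ bot) (e : (top ≫ m) ≫ pz ≅ g ≫ bot)
    (he : e.inv = η ≫ top ◁ t.inv ≫ (α_ _ _ _).inv)
    (w : (top ≫ m) ◁ l.hom ≫ e.hom = ((α_ _ _ _).inv ≫ s.hom ▷ r ≫ (α_ _ _ _).hom) ≫ g ◁ k.hom) :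
    HasLift r g (top ≫ m ≫ inl) bot
      (η ≫ top ◁ (α_ m inl r ≪≫ whiskerLeftIso m l ≪≫ t).inv ≫ (α_ _ _ _).inv) := by
  refine ⟨inr, s.inv ≫ (α_ _ _ _).hom, k.inv, ?_⟩
  have w' : whiskerLeftIso (top ≫ m) l ≪≫ e =
    ((α_ _ _ _).symm ≪≫ whiskerRightIso s r ≪≫ α_ _ _ _) ≪≫ whiskerLeftIso g k := Iso.ext w
  have w₁ := congrArg Iso.inv w'
  simp only [Iso.trans_inv, whiskerLeftIso_inv, whiskerRightIso_inv, Iso.symm_inv,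
    Category.assoc, he] at w₁
  rw [comp_whiskerRight, ← cancel_mono (α_ top (m ≫ inl) r).hom, ← cancel_mono
    (top ◁ (α_ m inl r).hom)]
  simp only [Category.assoc] at w₁ ⊢
  have h₁ : (α_ top m inl).hom ▷ r ≫ (α_ top (m ≫ inl) r).hom ≫ top ◁ (α_ m inl r).hom =
    (α_ (top ≫ m) inl r).hom ≫ (α_ top m (inl ≫ r)).hom := by simp
  rw [h₁, ← reassoc_of% w₁]
  simp

theorem whisker_unit_aux {a b x P : C} {top : a ⟶ x} {n : x ⟶ x} (u : n ≅ 𝟙 x) {inl : x ⟶ P}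
    {g : a ⟶ b} {inr : b ⟶ P} (s : top ≫ inl ≅ g ≫ inr) :
    top ◁ ((λ_ inl).symm ≪≫ (whiskerRightIso u inl).symm).hom ≫
        (whiskerLeftIso top (whiskerRightIso u inl ≪≫ λ_ inl) ≪≫ s).hom =
      s.hom ≫ g ◁ (Iso.refl inr).hom := by
  simp

theorem exists_extension_of_isMax [Bicategory.Strict C] [IsLocallyGroupoid C] (hC : TwoCocomplete C)
    [WellFoundedLT K] (G : Chain Y K) (t : K) (ht : ∀ i, i ≤ t)
    (hG : Arr.mk (G.aug t) ∉ inj I) :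
    ∃ E : Chain Y (WithTop K), E.pull (inclWithTop K) = G ∧ E.Good I f ⊤ := by
  -- The earliest stage posing a problem unsolved at `t` exists by well-foundedness, since `t`
  -- itself poses one.
  have hex : ∃ a, ∃ q : Problem I (G.aug a), ¬ G.Solved (ht a) q :=
    ⟨t, exists_not_solved hG⟩
  obtain ⟨a, ⟨q, hq⟩, hmin⟩ := wellFounded_lt.has_min _ hex
  obtain ⟨P, s, hs⟩ := exists_isPushout (h := q.top ≫ G.map (ht a)) (g := q.gen.1.hom) hC
  -- Invertibility of 2-cells turns the lifting problem, moved to `t`, into a square under the span.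
  let η : (q.top ≫ G.map (ht a)) ≫ G.aug t ≅ q.gen.1.hom ≫ q.bot :=
    (asIso (q.cell ≫ q.top ◁ (G.augComp (ht a)).inv ≫ (α_ _ _ _).inv)).symm
  have := hs Y
  obtain ⟨r, ⟨θ⟩⟩ := Functor.EssSurj.mem_essImage (F := s.homFunctor Y) ⟨G.aug t, q.bot, η⟩
  let l : s.inl ≫ r ≅ G.aug t := ⟨θ.hom.left, θ.inv.left,
    congrArg SpanCocone.Hom.left θ.hom_inv_id, congrArg SpanCocone.Hom.left θ.inv_hom_id⟩
  let k : s.inr ≫ r ≅ q.bot := ⟨θ.hom.right, θ.inv.right,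
    congrArg SpanCocone.Hom.right θ.hom_inv_id, congrArg SpanCocone.Hom.right θ.inv_hom_id⟩
  let c := (G.coconeTop t ht).postcomp s.inl
  let p : (c.homFunctor Y).obj r ≅ G.augCocone :=
    compAugIso (G.coconeTop t ht) (topAugIso G t ht) l
  refine ⟨G.snoc c r p, rfl, fun h => ?_, fun {i} h => ?_, fun h => ?_⟩
  · exact absurd (WithTop.coe_lt_top t) h.not_lt
  · have hi : i = (t : WithTop K) := by
      refine le_antisymm ?_ (not_lt.1 fun hlt => h.2 hlt (WithTop.coe_lt_top t))
      induction i with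
      | top => exact absurd h.lt (lt_irrefl _)
      | coe i => exact WithTop.coe_le_coe.2 (ht i)
    subst hi
    -- The new transition map from `t` is `G.map (ht t) ≫ s.inl` rather than `s.inl`, so the pushout
    -- square is corrected by `G.mapId t`.
    refine ⟨⟨q.gen.1, q.gen.2, q.top ≫ G.map (ht a), ⟨G.map (ht t) ≫ s.inl, s.inr,
      whiskerLeftIso _ (whiskerRightIso (G.mapId t) s.inl ≪≫ λ_ s.inl) ≪≫ s.iso⟩, ?_, rfl⟩, ?_⟩
    · exact hs.of_iso ((λ_ s.inl).symm ≪≫ (whiskerRightIso (G.mapId t) s.inl).symm)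
        (Iso.refl _) (whisker_unit_aux (G.mapId t) s.iso)
    · refine ⟨(a : WithTop K), WithTop.coe_le_coe.2 (ht a), q, hq, ?_, fun b hb => ?_⟩
      · exact solved_snoc_aux (G.augComp (ht a)) s.iso l k η rfl θ.hom.w
      · induction b with
        | top => exact absurd hb not_top_lt
        | coe b =>
          intro q'
          by_contra hq'
          exact hmin b ⟨q', hq'⟩ (WithTop.coe_lt_coe.1 hb)
  · refine absurd ⟨WithTop.coe_lt_top t, fun b hb hb' => ?_⟩ (h.2 (t : WithTop K))
    induction b with
    | top => exact lt_irrefl _ hb'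
    | coe b => exact (WithTop.coe_lt_coe.1 hb).not_ge (ht b)

end Chain

end Extension

end TwoOne

namespace TwoOne

/-! ### Transfinite recursion. -/

section Recursion

theorem PseudoCocone.IsColimit.of_iso {C : Type u₂} [Bicategory.{w₂, v₂} C] {K : Type u₁}
    [Bicategory.{w₁, v₁} K] {F : K ⥤ᵖ C} {a : C} {c d : PseudoCocone F a} (hc : c.IsColimit)
    (e : c ≅ d) : d.IsColimit := by
  intro b
  have := hc b
  refine Functor.isEquivalence_of_iso (F := c.homFunctor b) (NatIso.ofComponents
    (fun m => PseudoCocone.isoMk (fun i => whiskerRightIso (PseudoCocone.isoApp e i) m) ?_)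
    fun {m m'} η => PseudoCocone.homFunctor_ext fun i => whisker_exchange _ _)
  intro i j φ
  change F.map φ ◁ (PseudoCocone.isoApp e j).hom ▷ m ≫ (α_ _ _ _).inv ≫ (d.comm φ).hom ▷ m =
    ((α_ _ _ _).inv ≫ (c.comm φ).hom ▷ m) ≫ (PseudoCocone.isoApp e i).hom ▷ m
  rw [Category.assoc, ← comp_whiskerRight, ← PseudoCocone.isoApp_naturality]
  simp

namespace Chain

variable {C : Type u} [Bicategory.{v, v} C] {X Y : C}

theorem exists_isColimit [Bicategory.Strict C] (hC : TwoCocomplete C) {K : Type u₁}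
    [PartialOrder K] [Small.{v} K] (G : Chain Y K) :
    ∃ (a : C) (c : PseudoCocone G.toPseudo a), c.IsColimit := by
  suffices h : ∀ (K' : Type v) [Preorder K'], K' ≃o K →
      ∃ (a : C) (c : PseudoCocone G.toPseudo a), c.IsColimit from
    h (Shrink.{v} K) (orderIsoShrink K).symm
  intro K' _ e
  obtain ⟨a, c, hc⟩ := exists_isColimit_of_small hC (G.pull (e : K' →o K))
  obtain ⟨d, ⟨i⟩⟩ := Functor.EssSurj.mem_essImage (F := G.pullFunctor (e : K' →o K) a) c
  exact ⟨a, d, (isColimit_pullCocone_iff d e).1 (hc.of_iso i.symm)⟩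

variable {I : Set (Arr C)} {f : X ⟶ Y} {J : Type u₁} [LinearOrder J]

theorem exists_extension_withTop [Bicategory.Strict C] [IsLocallyGroupoid C]
    (hC : TwoCocomplete C) {K : Type u₁} [LinearOrder K] [WellFoundedLT K] [Small.{v} K]
    (G : Chain Y K) (hinj : ∀ t, (∀ i, i ≤ t) → Arr.mk (G.aug t) ∉ inj I) :
    ∃ E : Chain Y (WithTop K), E.pull (inclWithTop K) = G ∧ E.Good I f ⊤ := by
  by_cases h : ∃ t : K, ∀ i, i ≤ t
  · obtain ⟨t, ht⟩ := h
    exact exists_extension_of_isMax hC G t ht (hinj t ht)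
  · rcases isEmpty_or_nonempty K with _ | _
    · exact exists_extension_of_isEmpty G
    · push Not at h
      have : NoMaxOrder K := ⟨h⟩
      obtain ⟨a, c, hc⟩ := exists_isColimit hC G
      exact exists_extension_of_noMax G c hc

theorem isInitial_inclWithTop {K : Type u₁} [LinearOrder K] : IsInitial (inclWithTop K) where
  le_iff := WithTop.coe_le_coe
  mem_range {a b} h := by
    induction b with
    | top => exact absurd h (WithTop.not_top_le_coe a)
    | coe b => exact ⟨b, rfl⟩

theorem isInitial_inclLower {s : Set J} (hs : IsLowerSet s) (l : s) :
    IsInitial (inclLower hs l) where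
  le_iff := Iff.rfl
  mem_range {a b} h := ⟨⟨b.1, le_trans (show b.1 ≤ a.1 from h) a.2⟩, rfl⟩

/-- The closed initial segment, seen as an extension of the open one by a largest element. -/
noncomputable def iicToWithTop (β : J) : Set.Iic β →o WithTop (Set.Iio β) where
  toFun i := open Classical in if h : i.1 < β then ((⟨i.1, h⟩ : Set.Iio β) : WithTop (Set.Iio β))
    else ⊤
  monotone' i j h := by
    dsimp only
    split_ifs with h₁ h₂
    · exact WithTop.coe_le_coe.2 h
    · exact le_top
    · exact absurd (lt_of_le_of_lt (show i.1 ≤ j.1 from h) ‹_›) h₁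
    · exact le_rfl

theorem iicToWithTop_of_lt {β : J} {i : Set.Iic β} (h : i.1 < β) :
    iicToWithTop β i = ((⟨i.1, h⟩ : Set.Iio β) : WithTop (Set.Iio β)) := dif_pos h

theorem iicToWithTop_of_not_lt {β : J} {i : Set.Iic β} (h : ¬ i.1 < β) :
    iicToWithTop β i = ⊤ := dif_neg h

theorem isInitial_iicToWithTop (β : J) : IsInitial (iicToWithTop β) where
  le_iff {a b} := by
    refine ⟨fun h => ?_, fun h => (iicToWithTop β).monotone h⟩
    by_cases hb : b.1 < β
    · by_cases ha : a.1 < β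
      · rw [iicToWithTop_of_lt ha, iicToWithTop_of_lt hb] at h
        exact (WithTop.coe_le_coe.1 h : (⟨a.1, ha⟩ : Set.Iio β) ≤ ⟨b.1, hb⟩)
      · rw [iicToWithTop_of_not_lt ha, iicToWithTop_of_lt hb] at h
        exact absurd h (WithTop.not_top_le_coe _)
    · exact show a.1 ≤ b.1 from le_trans a.2 (not_lt.1 hb)
  mem_range {a b} _ := by
    induction b with
    | top => exact ⟨⟨β, le_rfl⟩, iicToWithTop_of_not_lt (lt_irrefl β)⟩
    | coe b => exact ⟨⟨b.1, le_of_lt b.2⟩, iicToWithTop_of_lt b.2⟩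

/-- The inclusion of the open initial segment in the closed one. -/
def iioToIic (β : J) : Set.Iio β →o Set.Iic β :=
  ⟨fun i => ⟨i.1, le_of_lt i.2⟩, fun _ _ h => h⟩

/-- An equality of monotone maps, so that the extension over `Set.Iic β` restricts strictly to the
given chain after `pull`. -/
theorem iicToWithTop_comp (β : J) :
    (iicToWithTop β).comp (iioToIic β) = inclWithTop (Set.Iio β) :=
  OrderHom.ext _ _ (funext fun i => iicToWithTop_of_lt (i := iioToIic β i) i.2)

theorem exists_extension [Bicategory.Strict C] [IsLocallyGroupoid C] (hC : TwoCocomplete C)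
    [WellFoundedLT J] (β : J) [Small.{v} (Set.Iio β)] (G : Chain Y (Set.Iio β))
    (hG : ∀ i, G.Good I f i) (hinj : ∀ t, (∀ i, i ≤ t) → Arr.mk (G.aug t) ∉ inj I) :
    ∃ E : Chain Y (Set.Iic β), E.pull (iioToIic β) = G ∧ ∀ i, E.Good I f i := by
  obtain ⟨E, rfl, hE⟩ := exists_extension_withTop (f := f) hC G hinj
  refine ⟨E.pull (iicToWithTop β), ?_, fun i => ?_⟩
  · exact congrArg E.pull (iicToWithTop_comp β)
  · rw [good_pull_iff (isInitial_iicToWithTop β)]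
    by_cases hi : i.1 < β
    · rw [iicToWithTop_of_lt hi]
      exact (good_pull_iff isInitial_inclWithTop (⟨i.1, hi⟩ : Set.Iio β)).1
        (hG (⟨i.1, hi⟩ : Set.Iio β))
    · rw [iicToWithTop_of_not_lt hi]
      exact hE

/-- The constant chain at `Y`; it only serves to make `Classical.epsilon` available in the
recursion. -/
instance {K : Type u₁} [Preorder K] : Nonempty (Chain Y K) :=
  ⟨{ obj := fun _ => Y
     maps := { map := fun _ => 𝟙 Y, aug := fun _ => 𝟙 Y }
     cells :=
      { mapId := fun _ => Iso.refl _
        mapComp := fun _ _ => (λ_ _).symm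
        augComp := fun _ => λ_ _
        assoc := by intros; simp
        left_unit := by intros; simp
        right_unit := by intros; simp
        aug_id := by intros; simp
        aug_comp := by intros; simp } }⟩

theorem good_of_glue {s : Set J} {hs : IsLowerSet s} {G : Chain Y s}
    {S : ∀ β : J, Chain Y (Set.Iic β)} (hS : ∀ l : s, ∀ i, (S l.1).Good I f i)
    (h : ∀ l : s, G.pull (inclLower hs l) = S l.1) (i : s) : G.Good I f i := by
  refine (good_pull_iff (isInitial_inclLower hs i) ⟨i.1, le_rfl⟩).1 ?_
  rw [h]
  exact hS i _

/-- A transfinite recursion builds a diagram all of whose stages are good, unless an earlier stage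
already has the right lifting property. -/
theorem exists_good [Bicategory.Strict C] [IsLocallyGroupoid C] (hC : TwoCocomplete C)
    [WellFoundedLT J] [∀ β : J, Small.{v} (Set.Iio β)]
    (hinj : ∀ (β : J) (G : Chain Y (Set.Iio β)), (∀ i, G.Good I f i) →
      ∀ t, (∀ i, i ≤ t) → Arr.mk (G.aug t) ∉ inj I) :
    ∃ G : Chain Y J, ∀ i, G.Good I f i := by
  let P : ∀ β : J, (∀ k, k < β → Chain Y (Set.Iic k)) → Chain Y (Set.Iic β) → Prop :=
    fun β prev E => (∀ (k) (hk : k < β), E.pull (inclIic hk.le) = prev k hk) ∧ ∀ i, E.Good I f i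
  -- The choice is made before a good extension is known to exist; `hP` shows by induction that one
  -- does, by gluing the earlier choices and extending once.
  let S : ∀ β : J, Chain Y (Set.Iic β) := (wellFounded_lt (α := J)).fix fun β prev =>
    Classical.epsilon (P β prev)
  have hS : ∀ β, S β = Classical.epsilon (P β fun k _ => S k) := fun β =>
    (wellFounded_lt (α := J)).fix_eq _ β
  have hP : ∀ β, P β (fun k _ => S k) (S β) := by
    intro β
    induction β using (wellFounded_lt (α := J)).induction with
    | _ β ih =>
    rw [hS]
    refine Classical.epsilon_spec (p := P β fun k _ => S k) ?_
    obtain ⟨G, hG⟩ := exists_glue (isLowerSet_Iio β) (fun l => S l.1) fun k l h => by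
      obtain hlt | heq := h.lt_or_eq
      · exact (ih l.1 l.2).1 k.1 hlt
      · obtain rfl := Subtype.ext heq
        rfl
    have hgood : ∀ i, G.Good I f i := good_of_glue (fun l => (ih l.1 l.2).2) hG
    obtain ⟨E, rfl, hE⟩ := exists_extension hC β G hgood (hinj β G hgood)
    exact ⟨E, fun k hk => hG ⟨k, hk⟩, hE⟩
  obtain ⟨G, hG⟩ := exists_glue isLowerSet_univ (fun l : (Set.univ : Set J) => S l.1)
    fun k l h => by
      obtain hlt | heq := h.lt_or_eq
      · exact (hP l.1).1 k.1 hlt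
      · obtain rfl := Subtype.ext heq
        rfl
  have hgood : ∀ i, G.Good I f i := good_of_glue (fun l => (hP l.1).2) hG
  let e : J →o (Set.univ : Set J) := ⟨fun i => ⟨i, trivial⟩, fun _ _ h => h⟩
  have he : IsInitial e := ⟨Iff.rfl, fun {a b} _ => ⟨b.1, rfl⟩⟩
  exact ⟨G.pull e, fun i => (good_pull_iff he i).2 (hgood _)⟩

end Chain

end Recursion

end TwoOne

namespace TwoOne

/-! ### From good chains to relative cell complexes. -/

section Cells

variable {C : Type u} [Bicategory.{v, v} C] {X Y : C}

theorem IsInitial.of_orderIso {K : Type u₁} [LinearOrder K] {K' : Type u₂} [LinearOrder K']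
    (e : K' ≃o K) : IsInitial (e : K' →o K) where
  le_iff := e.le_iff_le
  mem_range {_ b} _ := ⟨e.symm b, e.apply_symm_apply b⟩

theorem isInitial_inclIio {K : Type u₁} [LinearOrder K] (k : K) :
    IsInitial (Chain.inclIio k) where
  le_iff := Iff.rfl
  mem_range {a b} h := ⟨⟨b, lt_of_le_of_lt h a.2⟩, rfl⟩

namespace Chain

variable {I : Set (Arr C)} {f : X ⟶ Y}

theorem isContinuous_of_good {J : Type u₁} [LinearOrder J] {G : Chain Y J}
    (hG : ∀ i, G.Good I f i) : IsContinuous G.toPseudo :=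
  fun j hj => isColimit_coconeAt G j ((hG j).limit hj)

/-- The value at a largest index is the 2-colimit of the whole chain. The shape is first replaced by
a copy in `Type v`, since the chains in use are indexed by segments of `Ordinal.{v}`. -/
theorem map_mem_cell {K : Type u₁} [LinearOrder K] [WellFoundedLT K] [Small.{v} K]
    {G : Chain Y K} (hG : ∀ i, G.Good I f i) {m t : K} (hm : ∀ i, m ≤ i) (ht : ∀ i, i ≤ t) :
    Arr.mk (G.map (hm t)) ∈ cell I := by
  suffices h : ∀ (J : Type v) [LinearOrder J] [WellFoundedLT J], J ≃o K →
      Arr.mk (G.map (hm t)) ∈ cell I from h (Shrink.{v} K) (orderIsoShrink K).symm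
  intro J _ _ e
  obtain ⟨m, rfl⟩ := e.surjective m
  obtain ⟨t, rfl⟩ := e.surjective t
  have hG' : ∀ j, (G.pull (e : J →o K)).Good I f j := fun j =>
    (good_pull_iff (IsInitial.of_orderIso e) j).2 (hG _)
  exact ⟨J, inferInstance, inferInstance, { bot := m, bot_le := fun j => e.le_iff_le.1 (hm (e j)) },
    (G.pull (e : J →o K)).toPseudo, _,
    (G.pull (e : J →o K)).coconeTop t fun j => e.le_iff_le.1 (ht (e j)),
    isContinuous_of_good hG', fun i j h => ((hG' j).succ h).1, isColimit_coconeTop _ _ _, rfl⟩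

/-- The monotone map that selects two comparable elements. -/
def pair {K : Type u₁} [Preorder K] {i j : K} (h : i ≤ j) : ULift.{v} Bool →o K where
  toFun b := bif b.down then j else i
  monotone' := by
    rintro ⟨_ | _⟩ ⟨_ | _⟩ hb
    · exact le_rfl
    · exact h
    · exact absurd (show true ≤ false from hb) (by decide)
    · exact le_rfl

/-- A two-term sequence has no limit index and ends at its colimit. This is needed because smallness
is tested on diagrams with steps in `cell I`, whereas the steps here are pushouts. -/
theorem map_mem_cell_of_mem_pushouts {K : Type u₁} [Preorder K] {G : Chain Y K} {i j : K}
    (h : i ≤ j) (hG : Arr.mk (G.map h) ∈ pushouts I) : Arr.mk (G.map h) ∈ cell I := by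
  have hf : ∀ {a b : ULift.{v} Bool}, a < b → a = ⟨false⟩ ∧ b = ⟨true⟩ := by
    rintro ⟨_ | _⟩ ⟨_ | _⟩ hab
    · exact absurd hab (lt_irrefl _)
    · exact ⟨rfl, rfl⟩
    · exact absurd (show true < false from hab) (by decide)
    · exact absurd hab (lt_irrefl _)
  refine ⟨ULift.{v} Bool, inferInstance, inferInstance,
    { bot := ⟨false⟩, bot_le := fun b => Bool.false_le b.down },
    (G.pull (pair h)).toPseudo, _, (G.pull (pair h)).coconeTop ⟨true⟩ fun b => Bool.le_true b.down,
    fun k hk => ?_, fun a b hab => ?_, isColimit_coconeTop _ _ _, rfl⟩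
  · have : ∃ b, b < k := by
      have := hk.1
      rw [isMin_iff_forall_not_lt] at this
      push Not at this
      exact this
    obtain ⟨b, hb⟩ := this
    refine absurd ⟨hb, fun d hd hd' => ?_⟩ (hk.2 b)
    obtain ⟨_, rfl⟩ := hf hd
    obtain ⟨hd, _⟩ := hf hd'
    exact absurd hd (by simp)
  · obtain ⟨rfl, rfl⟩ := hf hab.lt
    exact hG

/-- The 1-cell factors, up to isomorphism, as the small object argument asserts. -/
def _root_.TwoOne.Factors (I : Set (Arr C)) (A : Arr C) : Prop :=
  ∃ (Z : C) (f' : A.left ⟶ Z) (f'' : Z ⟶ A.right),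
    Arr.mk f' ∈ cell I ∧ Arr.mk f'' ∈ inj I ∧ Nonempty (f' ≫ f'' ≅ A.hom)

theorem factors_of_mem_inj {K : Type u₁} [LinearOrder K] [WellFoundedLT K] [Small.{v} K]
    {G : Chain Y K} (hG : ∀ i, G.Good I f i) {t : K} (ht : ∀ i, i ≤ t)
    (hinj : Arr.mk (G.aug t) ∈ inj I) : Factors I (Arr.mk f) := by
  obtain ⟨m, -, hm⟩ := (wellFounded_lt (α := K)).has_min Set.univ ⟨t, trivial⟩
  have hm : ∀ i, m ≤ i := fun i => not_lt.1 (hm i trivial)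
  -- An equality of arrows, not of 1-cells between fixed objects: it replaces `X` together with `f`.
  rw [← (hG m).zero fun i _ => hm i]
  exact ⟨_, _, _, map_mem_cell hG hm ht, hinj, ⟨G.augComp (hm t)⟩⟩

end Chain

end Cells

/-! ### Cofinality and the stages at which problems are solved. -/

section Bounds

open Cardinal Ordinal Chain

theorem IsFilteredOrder.mono {κ κ' : Cardinal.{v}} (h : κ ≤ κ') {J : Type v} [LinearOrder J]
    (hJ : IsFilteredOrder κ' J) : IsFilteredOrder κ J :=
  ⟨hJ.1, fun S hS => hJ.2 S (hS.trans h)⟩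

/-- In a linear order an unbounded set is cofinal, so its cardinality is at least the cofinality. -/
theorem isFilteredOrder_toType {κ : Cardinal.{v}} {o : Ordinal.{v}} (ho : Order.IsSuccLimit o)
    (hκ : κ < o.cof) : IsFilteredOrder κ o.ToType := by
  refine ⟨⟨fun a => ?_⟩, fun S hS => ?_⟩
  · obtain ⟨⟨a, ha⟩, rfl⟩ := (ToType.mk (o := o)).surjective a
    exact ⟨ToType.mk ⟨Order.succ a, ho.succ_lt ha⟩,
      ToType.mk.lt_iff_lt.2 (Order.lt_succ a)⟩
  · by_contra h
    refine hκ.not_ge (le_trans ?_ hS)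
    rw [← cof_toType]
    refine Order.cof_le fun a => ?_
    by_contra ha
    push Not at ha
    exact h ⟨a, fun s hs => (ha s hs).le⟩

/-- The function `deriv g` is normal for arbitrary `g`, so its value at a regular cardinal above `κ`
has large cofinality. Its value at `succ i` bounds `g (succ (deriv g i))`, so the ordinals `succ
(deriv g i)` serve as `b`; `g` need not be monotone. -/
theorem exists_closed (g : Ordinal.{v} → Ordinal.{v}) (κ : Cardinal.{v}) :
    ∃ o : Ordinal.{v}, Order.IsSuccLimit o ∧ κ < o.cof ∧
      ∀ a < o, ∃ b, a ≤ b ∧ b < o ∧ g b ≤ o := by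
  let c := Order.succ (max κ ℵ₀)
  have hc : c.IsRegular := isRegular_succ (le_max_right _ _)
  have hcof : c ≤ (deriv g c.ord).cof :=
    hc.le_cof_ord.trans (le_cof_map_of_isNormal (isNormal_deriv g) _)
  have hlim : Order.IsSuccLimit c.ord :=
    one_lt_cof_iff.1 ((one_lt_aleph0.trans_le hc.aleph0_le).trans_le hc.le_cof_ord)
  refine ⟨deriv g c.ord, one_lt_cof_iff.1 ((one_lt_aleph0.trans_le hc.aleph0_le).trans_le hcof),
    (Order.lt_succ_of_le (le_max_left _ _)).trans_le hcof, fun a ha => ?_⟩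
  obtain ⟨i, hi, ha⟩ := ((isNormal_deriv g).lt_iff_exists_lt hlim).1 ha
  have h₁ : deriv g (Order.succ i) < deriv g c.ord := deriv_strictMono g (hlim.succ_lt hi)
  rw [deriv_succ] at h₁
  exact ⟨Order.succ (deriv g i), ha.le.trans (Order.le_succ _),
    (iterate_le_nfp g _ 0).trans_lt h₁, (iterate_le_nfp g _ 1).trans h₁.le⟩

variable {C : Type u} [Bicategory.{v, v} C] {X Y : C} {I : Set (Arr C)} {f : X ⟶ Y}

/-- All problems that appear up to a given stage are solved at some later stage. -/
theorem exists_solved [Small.{v} I] {G : Chain Y Ordinal.{v}} (hG : ∀ i, G.Good I f i)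
    (b : Ordinal.{v}) :
    ∃ (c : Ordinal.{v}) (hc : b ≤ c), ∀ (a) (ha : a ≤ b) (q : Problem I (G.aug a)),
      G.Solved (ha.trans hc) q := by
  by_contra! H
  have key : ∀ j, b ≤ j → ∃ (a : Set.Iic b) (q : Problem I (G.aug a)) (h : a.1 ≤ j),
      ¬ G.Solved h q ∧ G.Solved (h.trans (Order.le_succ j)) q := by
    intro j hj
    obtain ⟨-, a, ha, q, h₁, h₂, h₃⟩ := (hG (Order.succ j)).succ (Order.covBy_succ j)
    obtain ⟨a', ha', q', hq'⟩ := H j hj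
    -- By the earliest-first rule, an unsolved problem from `a' ≤ b` forces the step at `j` to treat
    -- one from a stage at most `a'`.
    refine ⟨⟨a, (not_lt.1 fun hlt => hq' (h₃ a' hlt q')).trans ha'⟩, q, ha, h₁, h₂⟩
  choose a q h h₁ h₂ using key
  -- Sending `o` to the problem treated at stage `b + o` would embed all ordinals in a small set;
  -- the shift by `b` keeps the stages above `b`.
  refine not_small_ordinal.{v, v} (small_of_injective
    (β := Σ a : Set.Iic b, Problem I (G.aug a))
    (f := fun o => ⟨a (b + o) le_self_add, q (b + o) le_self_add⟩) ?_)
  -- No problem is treated twice: it is solved right after `j`, hence at `j'`, where the problem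
  -- treated is unsolved.
  have hlt : ∀ j (hj : b ≤ j) j' (hj' : b ≤ j'), j < j' →
      (⟨a j hj, q j hj⟩ : Σ a : Set.Iic b, Problem I (G.aug a)) ≠ ⟨a j' hj', q j' hj'⟩ := by
    intro j hj j' hj' hlt heq
    have hs : ∀ x : Σ a : Set.Iic b, Problem I (G.aug a), x = ⟨a j hj, q j hj⟩ →
        ∀ hx : x.1.1 ≤ j', G.Solved hx x.2 := by
      rintro _ rfl hx
      exact (h₂ j hj).mono (Order.succ_le_of_lt hlt)
    exact h₁ j' hj' (hs _ heq.symm _)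
  intro o o' heq
  rcases lt_trichotomy o o' with hoo | rfl | hoo
  · exact absurd heq (hlt _ _ _ _ (by gcongr))
  · rfl
  · exact absurd heq.symm (hlt _ _ _ _ (by gcongr))

end Bounds

end TwoOne

namespace TwoOne

/-! ### Factoring through earlier stages, and the contradiction. -/

section Factorization

variable {C : Type u} [Bicategory.{v, v} C] [IsLocallyGroupoid C]

/-- The functor on `C(A, a)` that tests whether a 1-cell factors, up to isomorphism, through a
component of the cocone `c`. -/
def factorsThrough {K : Type u₁} [Bicategory.{w₁, v₁} K] {F : K ⥤ᵖ C} {a : C}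
    (c : PseudoCocone F a) (A : C) : (A ⟶ a) ⥤ Discrete (ULift.{v} Prop) where
  obj h := ⟨⟨∃ (i : K) (h' : A ⟶ F.obj i), Nonempty (h' ≫ c.ι i ≅ h)⟩⟩
  map η := eqToHom (congrArg (fun p => Discrete.mk (ULift.up p)) (propext
    ⟨fun ⟨i, h', ⟨e⟩⟩ => ⟨i, h', ⟨e ≪≫ asIso η⟩⟩,
      fun ⟨i, h', ⟨e⟩⟩ => ⟨i, h', ⟨e ≪≫ (asIso η).symm⟩⟩⟩))
  map_id _ := Subsingleton.elim _ _
  map_comp _ _ := Subsingleton.elim _ _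

/-- Makes the modification condition automatic for cocones with a discrete target category. -/
instance {A : Cat.{v, v}} {D : Type v} {F G : A ⟶ Cat.of (Discrete D)} : Subsingleton (F ⟶ G) :=
  ⟨fun _ _ => Cat.Hom₂.ext (NatTrans.ext (funext fun _ =>
    Subsingleton.elim (α := (_ : Discrete D) ⟶ _) _ _))⟩

/-- A 1-cell to a 2-colimit that is preserved by a representable 2-functor factors, up to
isomorphism, through the diagram. -/
theorem exists_factorization {K : Type u₁} [Bicategory.{w₁, v₁} K] {F : K ⥤ᵖ C} {a : C}
    (c : PseudoCocone F a) (A : C) (hc : (c.image (representable A)).IsColimit) (h : A ⟶ a) :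
    ∃ (i : K) (h' : A ⟶ F.obj i), Nonempty (h' ≫ c.ι i ≅ h) := by
  -- The predicate "factors through the diagram" and the constant `True` agree on every leg.
  -- Fullness of the comparison functor yields a 2-cell between them on all of `C(A, a)`, and in a
  -- discrete category that is an equality.
  let D : Cat.{v, v} := Cat.of (Discrete (ULift.{v} Prop))
  let T : (representable A).obj a ⟶ D := (factorsThrough c A).toCatHom
  let T' : (representable A).obj a ⟶ D := ((Functor.const (A ⟶ a)).obj ⟨⟨True⟩⟩).toCatHom
  have := hc D
  let φ : ((c.image (representable A)).homFunctor D).obj T ⟶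
      ((c.image (representable A)).homFunctor D).obj T' :=
    { app := fun i => NatTrans.toCatHom₂
        (F := postcomp A (c.ι i) ⋙ factorsThrough c A)
        (G := postcomp A (c.ι i) ⋙ (Functor.const (A ⟶ a)).obj ⟨⟨True⟩⟩)
        { app := fun h' => eqToHom (congrArg (fun p => Discrete.mk (ULift.up p))
            (eq_true ⟨i, h', ⟨Iso.refl _⟩⟩))
          naturality := fun _ _ _ => Subsingleton.elim _ _ }
      naturality := fun _ => Subsingleton.elim _ _ }
  obtain ⟨θ, -⟩ := ((c.image (representable A)).homFunctor D).map_surjective φ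
  have e : (factorsThrough c A).obj h = ⟨⟨True⟩⟩ :=
    Discrete.ext (Discrete.eq_of_hom (θ.toNatTrans.app h))
  exact of_eq_true (congrArg (fun d => d.as.down) e)

end Factorization

namespace Chain

variable {C : Type u} [Bicategory.{v, v} C] [IsLocallyGroupoid C] {X Y : C} {I : Set (Arr C)}
  {f : X ⟶ Y}

/-- At a stage of large cofinality, a 1-cell from a small object comes from an earlier stage. -/
theorem exists_earlier {K : Type u₁} [LinearOrder K] [WellFoundedLT K] {G : Chain Y K}
    (hG : ∀ i, G.Good I f i) {o : K} (ho : Order.IsSuccLimit o) {J : Type v} [LinearOrder J]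
    (e : J ≃o Set.Iio o) {κ : Cardinal.{v}} (hJ : IsFilteredOrder κ J) {A : C}
    (hA : IsCardinalSmall (cell I) κ A) (h : A ⟶ G.obj o) :
    ∃ (b : K) (hb : b < o) (t : A ⟶ G.obj b), Nonempty (t ≫ G.map hb.le ≅ h) := by
  have : WellFoundedLT J := e.toOrderEmbedding.wellFoundedLT
  let H : Chain Y J := (G.pull (inclIio o)).pull (e : J →o Set.Iio o)
  have hH : ∀ j, H.Good I f j := fun j => (good_pull_iff (IsInitial.of_orderIso e) j).2
    ((good_pull_iff (isInitial_inclIio o) (e j)).2 (hG _))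
  have hc := (isColimit_pullCocone_iff (G.coconeBelow o) e).2 ((hG o).limit ho)
  obtain ⟨j, t, ht⟩ := exists_factorization _ A (hA J hJ H.toPseudo (isContinuous_of_good hH)
    (fun i j hij => map_mem_cell_of_mem_pushouts hij.le ((hH j).succ hij).1) _ _ hc) h
  exact ⟨(e j.as).1, (e j.as).2, t, ht⟩

theorem factors [Bicategory.Strict C] (hC : TwoCocomplete C) [Small.{v} I]
    (hI : ∀ g ∈ I, IsSmall (cell I) g.left) : Factors I (Arr.mk f) := by
  by_contra hf
  obtain ⟨G, hG⟩ := exists_good (I := I) (f := f) (J := Ordinal.{v}) hC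
    fun β G hG t ht hinj => hf (factors_of_mem_inj hG ht hinj)
  choose g hle hg using exists_solved hG
  choose κ hκ using fun i : I => hI i.1 i.2
  -- As `I` is small, one cardinal bounds all the smallness constants; `o` must be chosen before it
  -- is known which generator the step at `o` uses.
  obtain ⟨o, ho, hcof, hclosed⟩ := exists_closed g (⨆ i, κ i)
  obtain ⟨-, a, ha, q, hq, -⟩ := (hG (Order.succ o)).succ (Order.covBy_succ o)
  have hJ : IsFilteredOrder (κ q.gen) o.ToType :=
    (isFilteredOrder_toType ho hcof).mono (le_ciSup Cardinal.bddAbove_of_small q.gen)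
  obtain ⟨b, hb, t, ⟨β⟩⟩ := exists_earlier hG ho Ordinal.ToType.mk.symm hJ (hκ q.gen)
    (q.top ≫ G.map ha)
  obtain ⟨q', hq'⟩ := exists_problem ha hb.le q t β
  -- The problem is posed at `b ≤ d`, so it is solved at `g d ≤ o`, whereas `hq` says that `q` is
  -- unsolved at `o`.
  obtain ⟨d, hbd, -, hgd⟩ := hclosed b hb
  exact hq (hq' ((hg d b hbd q').mono hgd))

end Chain

end TwoOne

theorem mainTheorem3 {C : Type u} [Bicategory.{v, v} C] [Bicategory.Strict C]
    [IsLocallyGroupoid C] (hC : TwoOne.TwoCocomplete C)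
    (I : Set (TwoOne.Arr C)) [Small.{v} I]
    (hI : ∀ g ∈ I, TwoOne.IsSmall (TwoOne.cell I) g.left)
    {X Y : C} (f : X ⟶ Y) :
    ∃ (Z : C) (f' : X ⟶ Z) (f'' : Z ⟶ Y),
      TwoOne.Arr.mk f' ∈ TwoOne.cell I ∧ TwoOne.Arr.mk f'' ∈ TwoOne.inj I ∧
        Nonempty (f' ≫ f'' ≅ f) :=
  TwoOne.Chain.factors hC hI
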